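/- Let $n$ be even and $m$ odd, and let $\Gamma$ be a finite Abelian group of order $mn$. Suppose that $\Gamma$ has a subgroup $H$ of order $m$ such that the quotient $K=\Gamma/H$, which has order $n$, satisfies the following condition: $n$ is odd, or $n$ is even and $K$ has a subgroup isomorphic to $\mathbb{Z}_2\oplus\mathbb{Z}_{2s}$ for some integer $s\ge 2$. (As $n$ is even here, this means that $\Gamma/H$ has a subgroup isomorphic to $\mathbb{Z}_2\oplus\mathbb{Z}_{2s}$ with $s\ge 2$.) Then the Dutch windmill graph $D_n^m$, which consists of $m$ copies of the cycle $C_n$ sharing exactly one common vertex, is $\Gamma$-harmonious; that is, there is an injection $f:V(D_n^m)\to\Gamma$ such that $xy\mapsto f(x)+f(y)$ is a bijection from $E(D_n^m)$ to $\Gamma$. -/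

import Mathlib

/-- The sum labelling `xy ↦ f x + f y` of unordered pairs induced by a vertex labelling `f`. -/
def inducedEdgeLabel {V Γ : Type*} [AddCommGroup Γ] (f : V → Γ) : Sym2 V → Γ :=
  Sym2.lift ⟨fun x y => f x + f y, fun x y => add_comm (f x) (f y)⟩

/-- `G` is `Γ`-harmonious: some injective vertex labelling with values in `Γ` induces, by sums, a
bijection from the edges of `G` onto `Γ` (so `Γ` has as many elements as `G` has edges). -/
def IsHarmonious {V : Type*} (G : SimpleGraph V) (Γ : Type*) [AddCommGroup Γ] : Prop :=
  ∃ f : V → Γ, Function.Injective f ∧ Set.BijOn (inducedEdgeLabel f) G.edgeSet Set.univ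

/-- Vertices of the Dutch windmill with `m` blades of length `n`: the central vertex `none`, and
the vertices `some (j, i)`, the `i`-th vertex (`1 ≤ i ≤ n - 1`) of the `j`-th blade. -/
abbrev WindmillVertex (n m : ℕ) : Type :=
  Option (Fin m × {i : Fin n // (i : ℕ) ≠ 0})

/-- The `j`-th copy of the vertex set `{0, …, n - 1}` of the cycle, its vertex `0` being the
central vertex. -/
def windmillBlade (n m : ℕ) (j : Fin m) (i : Fin n) : WindmillVertex n m :=
  if h : (i : ℕ) ≠ 0 then some (j, ⟨i, h⟩) else none

/-- The Dutch windmill graph `D_n^m` (for `n ≥ 3`): `m` copies of the cycle `C_n` which share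
exactly the central vertex. -/
def dutchWindmill (n m : ℕ) : SimpleGraph (WindmillVertex n m) :=
  ⨆ j : Fin m, (SimpleGraph.cycleGraph n).map (windmillBlade n m j)

/-- The group condition of the characterization of harmonious labellings of the cycle `C_n`:
`K` has order `n`, and either `n` is odd, or `n` is even and `K` has a subgroup isomorphic to
`Z_2 ⊕ Z_{2s}` for some `s ≥ 2`. -/
def CycleCondition (n : ℕ) (K : Type*) [AddCommGroup K] : Prop :=
  Nat.card K = n ∧
    (Odd n ∨
      (Even n ∧ ∃ s : ℕ, 2 ≤ s ∧
        ∃ S : AddSubgroup K, Nonempty (S ≃+ ZMod 2 × ZMod (2 * s))))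

/-! Write `K = Γ/H`. The group condition gives `K` two involutions and an element not killed by 2
(`IsAmple`), and what is needed from it is a complete mapping `θ` of `K` that is a single cycle: its
orbit `a₀, a₁, …` runs through `K`, and so do the sums of cyclically consecutive terms. On blade `j`
the vertex `i ≠ 0` receives a lift of `aᵢ` shifted by the `j`-th element `h` of `H`, while the
centre receives an unshifted lift of `a₀`. Over a fixed coset of `H` the edge sums vary with `j` by
`h` or `2h`, and as `m` is odd they fill the coset (`isHarmonious_dutchWindmill`).

The cycle `θ` is built by induction on the order of `K`, with a stronger claim, `IsSplittable`, that
also supplies a complete mapping `G` with two cycles. Lifting `θ` through an extension is easy over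
a cyclic kernel of odd order: one twist by a generator joins all the levels
(`IsSplittable.of_cyclic_odd_ker`). Over a Klein quotient with splittable kernel, a skew product
built from `θ` and `G` is complete and has three cycles, one on the kernel and two, copied from `G`,
over the other cosets. Exchanging the images of four points keeps the set of sums and merges the
three cycles (`splice`, `IsSplittable.of_klein_quotient`). The points `u` and `θ (θ u)` are placed
so that the four sum identities can be solved by choosing coset representatives.

The structure theorem makes `K` a product of cyclic groups of prime power order. If an odd prime
occurs, a subgroup of that prime order is factored out, unless this destroys ampleness; then `K` is
elementary abelian of exponent 2 times one group of odd prime order. For these groups and for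
2-groups a Klein quotient is split off whenever the kernel is ample or a cyclic group of prime order
at least 5. Left over are a few small groups, settled by explicit sequences, the products of the
elementary group of order eight with a prime at least 5 (`IsSplittable.of_octo_quotient`), and `Z_2
⊕ Z_{2^b}`, where every suitable kernel is cyclic. For `b ≥ 4` the last family has an explicit
permutation whose cycle structure reduces to a permutation of sixteen nodes, whatever the size
(`isSplittable_zmod_sixteen_mul`). -/

/-- A complete mapping of an abelian group: a permutation `θ` such that `x ↦ x + θ x` is also
bijective. -/
def IsCompleteMapping {K : Type*} [AddCommGroup K] (θ : Equiv.Perm K) : Prop :=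
  Function.Bijective fun x => x + θ x

/-- `K` has a complete mapping `θ` with a single cycle and a complete mapping `G` with exactly two
cycles, one containing some `u` and the other containing `θ (θ u)`. -/
def IsSplittable (K : Type*) [AddCommGroup K] : Prop :=
  ∃ θ G : Equiv.Perm K, IsCompleteMapping θ ∧ IsCompleteMapping G ∧ (∀ x y, θ.SameCycle x y) ∧
    ∃ u, ¬ G.SameCycle u (θ (θ u)) ∧ ∀ x, G.SameCycle u x ∨ G.SameCycle (θ (θ u)) x

/-! ### Cycles of permutations and surgery on them -/

section Cycles

theorem sameCycle_step {α : Type*} (f : Equiv.Perm α) (x : α) : f.SameCycle x (f x) :=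
  Equiv.Perm.sameCycle_apply_right.2 (Equiv.Perm.SameCycle.refl f x)

/-- What matters is that the right-hand side depends on the cardinality only: two single-cycle
permutations of one set have equal signs. -/
theorem sign_of_sameCycle {α : Type*} [Fintype α] [DecidableEq α] [Nontrivial α] {f : Equiv.Perm α}
    (h : ∀ x y, f.SameCycle x y) : Equiv.Perm.sign f = -(-1) ^ Fintype.card α := by
  have hne : ∀ x, f x ≠ x := by
    intro x hx
    obtain ⟨y, hy⟩ := exists_ne x
    obtain ⟨n, hn⟩ := h x y
    rw [Equiv.Perm.zpow_apply_eq_self_of_apply_eq_self hx] at hn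
    exact hy hn.symm
  obtain ⟨x, _, _⟩ := exists_pair_ne α
  have hc : f.IsCycle := ⟨x, hne x, fun y _ => h x y⟩
  have hs : f.support = Finset.univ := by
    ext y; simp [hne y]
  rw [hc.sign, hs, Finset.card_univ]

variable {α : Type*} [Finite α]

/-- A cycle with one arrow removed is still connected. -/
theorem rel_of_cut (f : Equiv.Perm α) (r : Setoid α) (a : α)
    (h : ∀ x, f.SameCycle a x → x ≠ a → r x (f x)) : r a (f a) := by
  classical
  have hper : Function.IsPeriodicPt f (orderOf f) a := by
    have h1 : (f ^ orderOf f) a = a := by rw [pow_orderOf_eq_one]; rfl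
    rwa [Equiv.Perm.coe_pow] at h1
  have hpos : 0 < Function.minimalPeriod f a :=
    Function.IsPeriodicPt.minimalPeriod_pos (orderOf_pos f) hper
  -- Walk forward from `f a`; before the first return to `a` the missing arrow is never met.
  have key : ∀ k, k + 1 ≤ Function.minimalPeriod f a → r (f a) (f^[k + 1] a) := by
    intro k
    induction k with
    | zero => intro _; exact r.refl _
    | succ k ih =>
      intro hk
      have h1 := ih (by omega)
      have hne : f^[k + 1] a ≠ a := by
        have := Function.not_isPeriodicPt_of_pos_of_lt_minimalPeriod (f := f) (x := a)
          (n := k + 1) (by omega) (by omega)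
        exact this
      have hsc : f.SameCycle a (f^[k + 1] a) := by
        rw [← Equiv.Perm.coe_pow]
        exact Equiv.Perm.sameCycle_pow_right.2 (Equiv.Perm.SameCycle.refl f a)
      have h2 := h _ hsc hne
      rw [Function.iterate_succ_apply' f (k + 1)]
      exact r.trans h1 h2
  obtain ⟨m, hm⟩ : ∃ m, Function.minimalPeriod f a = m + 1 := ⟨_, (Nat.succ_pred_eq_of_pos hpos).symm⟩
  have h1 := key m (by omega)
  rw [← hm, Function.iterate_minimalPeriod] at h1
  exact r.symm h1

theorem rel_of_sameCycle (f : Equiv.Perm α) (r : Setoid α) {a b : α}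
    (h : ∀ x, f.SameCycle a x → r x (f x)) (hab : f.SameCycle a b) : r a b := by
  obtain ⟨n, rfl⟩ := hab.exists_nat_pow_eq
  clear hab
  induction n with
  | zero => exact r.refl _
  | succ n ih =>
    refine r.trans ih ?_
    rw [pow_succ', Equiv.Perm.mul_apply]
    exact h _ (Equiv.Perm.sameCycle_pow_right.2 (Equiv.Perm.SameCycle.refl f a))

theorem mem_of_sameCycle (f : Equiv.Perm α) (S : Set α) (hS : ∀ x ∈ S, f x ∈ S) {a b : α}
    (hab : f.SameCycle a b) (ha : a ∈ S) : b ∈ S := by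
  obtain ⟨n, rfl⟩ := hab.exists_nat_pow_eq
  clear hab
  induction n with
  | zero => exact ha
  | succ n ih => rw [pow_succ', Equiv.Perm.mul_apply]; exact hS _ ih

theorem sameCycle_map {β : Type*} {f : Equiv.Perm α} {g : Equiv.Perm β} (p : α → β)
    (h : ∀ x, p (f x) = g (p x)) {a b : α} (hab : f.SameCycle a b) : g.SameCycle (p a) (p b) := by
  obtain ⟨n, rfl⟩ := hab.exists_nat_pow_eq
  clear hab
  induction n with
  | zero => exact Equiv.Perm.SameCycle.refl _ _
  | succ n ih =>
    rw [pow_succ', Equiv.Perm.mul_apply, h]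
    exact Equiv.Perm.sameCycle_apply_right.2 ih

/-- Redirecting four arrows merges three cycles into one. -/
theorem splice (f g : Equiv.Perm α) (U₀ U₁ U₂ U₃ : α)
    (hcov : ∀ x, f.SameCycle U₀ x ∨ f.SameCycle U₁ x ∨ f.SameCycle U₂ x)
    (h01 : ¬ f.SameCycle U₀ U₁) (h02 : ¬ f.SameCycle U₀ U₂) (h12 : ¬ f.SameCycle U₁ U₂)
    (h03 : ¬ f.SameCycle U₀ U₃)
    (g0 : g U₀ = f U₃) (g1 : g U₁ = f U₂) (g3 : g U₃ = f U₀)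
    (hg : ∀ x, x ≠ U₀ → x ≠ U₁ → x ≠ U₂ → x ≠ U₃ → g x = f x) (x y : α) :
    g.SameCycle x y := by
  classical
  let r := Equiv.Perm.SameCycle.setoid g
  have hr : ∀ x, r x (g x) := fun x => sameCycle_step g x
  -- The `f`-cycle of `U₀` avoids the other three points, so it loses a single arrow and stays
  -- connected under `g`.
  have e0 : r U₀ (f U₀) := by
    apply rel_of_cut
    intro x hx hne
    have h1 : x ≠ U₁ := fun h => h01 (h ▸ hx)
    have h2 : x ≠ U₂ := fun h => h02 (h ▸ hx)
    have h3 : x ≠ U₃ := fun h => h03 (h ▸ hx)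
    rw [← hg x hne h1 h2 h3]; exact hr x
  -- The redirected arrows `U₃ → f U₀` and `U₀ → f U₃` bridge the gap. Only the arrows at `U₁` and
  -- `U₂` remain in doubt, and these lie on different `f`-cycles, so each is again a single cut; it
  -- is irrelevant which of the two contains `U₃`.
  have e3 : r U₃ (f U₃) := by
    have a1 : r U₃ (f U₀) := g3 ▸ hr U₃
    have a2 : r U₀ (f U₃) := g0 ▸ hr U₀
    exact r.trans a1 (r.trans (r.symm e0) a2)
  have gen : ∀ x, x ≠ U₁ → x ≠ U₂ → r x (f x) := by
    intro x h1 h2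
    by_cases h0 : x = U₀
    · rw [h0]; exact e0
    by_cases h3 : x = U₃
    · rw [h3]; exact e3
    rw [← hg x h0 h1 h2 h3]; exact hr x
  have e1 : r U₁ (f U₁) := by
    apply rel_of_cut
    intro x hx hne
    exact gen x hne (fun h => h12 (h ▸ hx))
  have e2 : r U₂ (f U₂) := by
    apply rel_of_cut
    intro x hx hne
    exact gen x (fun h => h12 (h ▸ hx).symm) hne
  have all : ∀ x, r x (f x) := by
    intro x
    by_cases h1 : x = U₁
    · rw [h1]; exact e1
    by_cases h2 : x = U₂
    · rw [h2]; exact e2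
    exact gen x h1 h2
  have up : ∀ {a b}, f.SameCycle a b → r a b := fun hab => rel_of_sameCycle f r (fun x _ => all x) hab
  have c12 : r U₁ U₂ := r.trans (g1 ▸ hr U₁ : r U₁ (f U₂)) (r.symm e2)
  have c03 : r U₀ U₃ := r.trans (g0 ▸ hr U₀ : r U₀ (f U₃)) (r.symm e3)
  have c31 : r U₃ U₁ := by
    rcases hcov U₃ with h | h | h
    · exact absurd h h03
    · exact r.symm (up h)
    · exact r.trans (r.symm (up h)) (r.symm c12)
  have toU1 : ∀ x, r x U₁ := by
    intro x
    rcases hcov x with h | h | h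
    · exact r.trans (r.symm (up h)) (r.trans c03 c31)
    · exact r.symm (up h)
    · exact r.trans (r.symm (up h)) (r.symm c12)
  exact r.trans (toU1 x) (r.symm (toU1 y))

end Cycles

/-! ### Trading images without changing the sums -/

section Trade

variable {K : Type*} [AddCommGroup K]

/-- Exchanging the images of finitely many points of a complete mapping without changing the set
of their sums. -/
theorem IsCompleteMapping.exists_trade {θ : Equiv.Perm K} (hθ : IsCompleteMapping θ) {k : ℕ}
    (R : Fin k ↪ K) (σ π : Equiv.Perm (Fin k))
    (h : ∀ i, R i + θ (R (σ i)) = R (π i) + θ (R (π i))) :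
    ∃ G : Equiv.Perm K, IsCompleteMapping G ∧ (∀ i, G (R i) = θ (R (σ i))) ∧
      (∀ x, x ∉ Set.range R → G x = θ x) ∧
      (∀ [Fintype K] [DecidableEq K],
        Equiv.Perm.sign G = Equiv.Perm.sign θ * Equiv.Perm.sign σ) := by
  classical
  let e := σ.viaFintypeEmbedding R
  let d := π.viaFintypeEmbedding R
  refine ⟨θ * e, ?_, ?_, ?_, ?_⟩
  -- The new sum map is the old one precomposed with the extension of `π` to all of `K`.
  · have : (fun x => x + (θ * e) x) = (fun x => x + θ x) ∘ d := by
      funext x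
      by_cases hx : x ∈ Set.range R
      · obtain ⟨i, rfl⟩ := hx
        simp only [Equiv.Perm.mul_apply, Function.comp, e, d,
          Equiv.Perm.viaFintypeEmbedding_apply_image]
        exact h i
      · simp only [Equiv.Perm.mul_apply, Function.comp, e, d,
          Equiv.Perm.viaFintypeEmbedding_apply_notMem_range _ _ hx]
    unfold IsCompleteMapping
    rw [this]
    exact hθ.comp d.bijective
  · intro i
    simp [e, Equiv.Perm.viaFintypeEmbedding_apply_image]
  · intro x hx
    simp [e, Equiv.Perm.viaFintypeEmbedding_apply_notMem_range _ _ hx]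
  · intro _ _
    rw [Equiv.Perm.sign_mul]
    congr 1
    convert Equiv.Perm.viaFintypeEmbedding_sign σ R

end Trade

/-! ### From a single-cycle complete mapping to the windmill -/

section Windmill

/-- The orbit of `a` is everything, so its minimal period is the order of `K`. The second claim
closes the enumeration into a cycle of length `n`. -/
theorem exists_cyclic_enumeration {K : Type*} [Finite K] (θ : Equiv.Perm K)
    (hθ : ∀ x y, θ.SameCycle x y) (a : K) (n : ℕ) (hn : Nat.card K = n) :
    (Function.Bijective fun i : Fin n => θ^[i] a) ∧ θ^[n] a = a := by
  have hper : Function.IsPeriodicPt θ (orderOf θ) a := by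
    have h1 : (θ ^ orderOf θ) a = a := by rw [pow_orderOf_eq_one]; rfl
    rwa [Equiv.Perm.coe_pow] at h1
  have hpos : 0 < Function.minimalPeriod θ a :=
    Function.IsPeriodicPt.minimalPeriod_pos (orderOf_pos θ) hper
  have hb : Function.Bijective fun i : Fin (Function.minimalPeriod θ a) => θ^[i] a := by
    constructor
    · intro i j hij
      have := Function.iterate_injOn_Iio_minimalPeriod (f := θ) (x := a)
        (Set.mem_Iio.2 i.2) (Set.mem_Iio.2 j.2) hij
      exact Fin.ext this
    · intro y
      obtain ⟨m, hm⟩ := (hθ a y).exists_nat_pow_eq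
      refine ⟨⟨m % Function.minimalPeriod θ a, Nat.mod_lt _ hpos⟩, ?_⟩
      simp only
      rw [Function.iterate_mod_minimalPeriod_eq, ← Equiv.Perm.coe_pow, hm]
  have hc : Function.minimalPeriod θ a = n := by
    rw [← hn, ← Nat.card_eq_of_bijective _ hb, Nat.card_fin]
  rw [hc] at hb
  exact ⟨hb, hc ▸ Function.iterate_minimalPeriod⟩

theorem windmillBlade_injective (n m : ℕ) (j : Fin m) :
    Function.Injective (windmillBlade n m j) := by
  intro a b hab
  unfold windmillBlade at hab
  split_ifs at hab with h1 h2 h2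
  · simpa using hab
  · push Not at h1 h2
    exact Fin.ext (h1.trans h2.symm)

/-- The set of edges of the windmill is parametrized by pairs consisting of a blade and an edge
of the cycle. -/
theorem mem_dutchWindmill_edgeSet {n m : ℕ} [NeZero n] (hn : 2 < n)
    (e : Sym2 (WindmillVertex n m)) :
    e ∈ (dutchWindmill n m).edgeSet ↔
      ∃ (j : Fin m) (i : Fin n), e = s(windmillBlade n m j i, windmillBlade n m j (i + 1)) := by
  obtain ⟨n, rfl⟩ : ∃ k, n = k + 2 := ⟨n - 2, by omega⟩
  induction e using Sym2.ind with
  | _ x y =>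
  rw [SimpleGraph.mem_edgeSet, dutchWindmill, SimpleGraph.iSup_adj]
  constructor
  · rintro ⟨j, h⟩
    obtain ⟨-, a, b, hab, rfl, rfl⟩ := h
    rw [SimpleGraph.cycleGraph_adj] at hab
    rcases hab with h | h
    · refine ⟨j, b, ?_⟩
      rw [← h, add_sub_cancel, Sym2.eq_swap]
    · refine ⟨j, a, ?_⟩
      rw [← h, add_sub_cancel]
  · rintro ⟨j, i, h⟩
    refine ⟨j, ?_⟩
    have hadj : ((SimpleGraph.cycleGraph (n + 2)).map (windmillBlade (n + 2) m j)).Adj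
        (windmillBlade (n + 2) m j i) (windmillBlade (n + 2) m j (i + 1)) := by
      have hadj' : (SimpleGraph.cycleGraph (n + 2)).Adj i (i + 1) := by
        rw [SimpleGraph.cycleGraph_adj]; right; simp
      exact ⟨fun h => hadj'.ne (windmillBlade_injective _ _ _ h), i, i + 1, hadj', rfl, rfl⟩
    rcases Sym2.eq_iff.1 h with ⟨rfl, rfl⟩ | ⟨rfl, rfl⟩
    · exact hadj
    · exact hadj.symm

/-- The coset of an edge sum determines the position of the edge on its blade, because `θ` is
complete; the `H`-part then determines the blade. Injectivity suffices, as there are `m * n` labels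
and as many elements. -/
theorem isHarmonious_dutchWindmill {Γ : Type*} [AddCommGroup Γ] [Finite Γ] {n m : ℕ}
    (hn : 2 < n) (hm : Odd m) (hΓ : Nat.card Γ = m * n) (H : AddSubgroup Γ) (hH : Nat.card H = m)
    (hK : Nat.card (Γ ⧸ H) = n) (θ : Equiv.Perm (Γ ⧸ H)) (hc : IsCompleteMapping θ)
    (hθ : ∀ x y, θ.SameCycle x y) : IsHarmonious (dutchWindmill n m) Γ := by
  classical
  have : NeZero n := ⟨by omega⟩
  obtain ⟨hab, han⟩ := exists_cyclic_enumeration θ hθ 0 n hK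
  set a : Fin n → Γ ⧸ H := fun i => θ^[i] 0 with ha
  have hsucc : ∀ i : Fin n, a (i + 1) = θ (a i) := by
    intro i
    simp only [ha]
    rw [← Function.iterate_succ_apply' θ]
    rcases Nat.lt_or_ge (i.1 + 1) n with h | h
    · rw [Fin.val_add_one_of_lt' h]
    · have h1 : i.1 + 1 = n := by omega
      have h2 : ((i + 1 : Fin n) : ℕ) = 0 := by
        rw [Fin.val_add, Fin.val_one', Nat.add_mod_mod, h1, Nat.mod_self]
      rw [h2, Nat.succ_eq_add_one, h1, han]; rfl
  have hsum : Function.Injective fun i => a i + a (i + 1) := by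
    intro i j hij
    simp only [hsucc] at hij
    exact hab.1 (hc.1 hij)
  let t : Γ ⧸ H → Γ := Quotient.out
  have ht : ∀ q, ((t q : Γ) : Γ ⧸ H) = q := fun q => Quotient.out_eq q
  obtain ⟨h⟩ : Nonempty (Fin m ≃ H) := ⟨(Finite.equivFinOfCardEq hH).symm⟩
  -- The shift vanishes at position `0`, the vertex common to all blades, so that one label serves
  -- them all.
  let c : Fin m → Fin n → H := fun j i => if (i : ℕ) ≠ 0 then h j else 0
  let f : WindmillVertex n m → Γ := fun v =>
    match v with
    | none => t (a 0)
    | some (j, i) => t (a i.1) + h j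
  have hcne : ∀ j (i : Fin n), (i : ℕ) ≠ 0 → c j i = h j := fun j i hi => if_pos hi
  have hcz : ∀ j (i : Fin n), (i : ℕ) = 0 → c j i = 0 := fun j i hi => if_neg (not_not.2 hi)
  have hc0 : ∀ j, c j 0 = 0 := fun j => hcz j 0 rfl
  have hf : ∀ j i, f (windmillBlade n m j i) = t (a i) + c j i := by
    intro j i
    unfold windmillBlade
    by_cases hi : (i : ℕ) ≠ 0
    · simp only [hi, ne_eq, not_false_eq_true, dif_pos, f, hcne j i hi]
    · have : i = 0 := Fin.ext (by simpa using hi)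
      subst this
      simp [f, hc0]
  have hmk : ∀ (x : H), ((x : Γ) : Γ ⧸ H) = 0 := fun x => (QuotientAddGroup.eq_zero_iff _).2 x.2
  have hfinj : Function.Injective f := by
    have hq : ∀ (j : Fin m) (i : Fin n) (j' : Fin m) (i' : Fin n),
        t (a i) + c j i = t (a i') + c j' i' → i = i' ∧ c j i = c j' i' := by
      intro j i j' i' hh
      have h1 := congrArg (fun x : Γ => (x : Γ ⧸ H)) hh
      simp only [QuotientAddGroup.mk_add, ht, hmk, add_zero] at h1
      have h2 := hab.1 h1
      subst h2
      exact ⟨rfl, Subtype.ext (add_left_cancel hh)⟩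
    rintro (_ | ⟨j, i, hi⟩) (_ | ⟨j', i', hi'⟩) hxy
    · rfl
    · have := hq j' 0 j' i' (by simpa [f, hc0, hcne _ _ hi'] using hxy)
      exact absurd (by rw [← this.1]; rfl) hi'
    · have := hq j i j 0 (by simpa [f, hc0, hcne _ _ hi] using hxy)
      exact absurd (by rw [this.1]; rfl) hi
    · have := hq j i j' i' (by simpa [f, hcne _ _ hi, hcne _ _ hi'] using hxy)
      obtain ⟨rfl, h2⟩ := this
      have : h j = h j' := by rwa [hcne _ _ hi, hcne _ _ hi] at h2
      rw [h.injective this]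
  have hodd : ∀ x y : H, x + x = y + y → x = y := by
    intro x y hxy
    have h1 : (2 : ℕ) • (x - y) = 0 := by
      rw [two_nsmul]; rw [← sub_eq_zero] at hxy; rw [← hxy]; abel
    have h2 : addOrderOf (x - y) ∣ 2 := addOrderOf_dvd_of_nsmul_eq_zero h1
    have h3 : addOrderOf (x - y) ∣ m := hH ▸ addOrderOf_dvd_natCard (x - y)
    have h4 : addOrderOf (x - y) ∣ 1 := by
      have := Nat.dvd_gcd h2 h3
      rwa [Nat.Coprime.gcd_eq_one (Nat.coprime_two_left.2 hm)] at this
    exact sub_eq_zero.1 (AddMonoid.addOrderOf_eq_one_iff.1 (Nat.dvd_one.1 h4))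
  let lab : Fin m × Fin n → Γ := fun p =>
    f (windmillBlade n m p.1 p.2) + f (windmillBlade n m p.1 (p.2 + 1))
  have hlabinj : Function.Injective lab := by
    rintro ⟨j, i⟩ ⟨j', i'⟩ hh
    simp only [lab, hf] at hh
    have h1 := congrArg (fun x : Γ => (x : Γ ⧸ H)) hh
    simp only [QuotientAddGroup.mk_add, ht, hmk, add_zero] at h1
    have h2 := hsum h1
    subst h2
    have h3 : c j i + c j (i + 1) = c j' i + c j' (i + 1) := by
      apply Subtype.ext
      push_cast
      have : (t (a i) + t (a (i + 1))) + ((c j i : Γ) + c j (i + 1)) =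
          (t (a i) + t (a (i + 1))) + ((c j' i : Γ) + c j' (i + 1)) := by
        calc _ = _ := by abel
          _ = _ := hh
          _ = _ := by abel
      exact add_left_cancel this
    have h4 : h j = h j' := by
      -- An edge at the centre carries `h j` once, any other edge twice; only in the latter case is
      -- the odd order of `H` used.
      by_cases hi : (i : ℕ) = 0
      · have hi1 : ((i + 1 : Fin n) : ℕ) ≠ 0 := by
          rw [Fin.val_add_one_of_lt' (by omega)]; omega
        simpa only [hcz _ _ hi, hcne _ _ hi1, zero_add] using h3
      · by_cases hi1 : ((i + 1 : Fin n) : ℕ) = 0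
        · simpa only [hcz _ _ hi1, hcne _ _ hi, add_zero] using h3
        · apply hodd
          simpa only [hcne _ _ hi, hcne _ _ hi1] using h3
    rw [h.injective h4]
  have hlab : Function.Bijective lab := by
    have : Fintype Γ := Fintype.ofFinite Γ
    rw [Fintype.bijective_iff_injective_and_card]
    refine ⟨hlabinj, ?_⟩
    rw [Fintype.card_prod, Fintype.card_fin, Fintype.card_fin, ← Nat.card_eq_fintype_card, hΓ]
  refine ⟨f, hfinj, fun _ _ => Set.mem_univ _, ?_, ?_⟩
  · intro e he e' he' hee
    obtain ⟨j, i, rfl⟩ := (mem_dutchWindmill_edgeSet hn e).1 he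
    obtain ⟨j', i', rfl⟩ := (mem_dutchWindmill_edgeSet hn e').1 he'
    have : (j, i) = (j', i') := hlabinj hee
    cases this
    rfl
  · intro γ _
    obtain ⟨⟨j, i⟩, hp⟩ := hlab.2 γ
    exact ⟨_, (mem_dutchWindmill_edgeSet hn _).2 ⟨j, i, rfl⟩, hp⟩

end Windmill

/-! ### Skew products -/

section Shear

variable {Q N : Type*}

/-- The skew product of `σ` with the permutations `ψ q`. -/
def shear (σ : Equiv.Perm Q) (ψ : Q → Equiv.Perm N) : Equiv.Perm (Q × N) :=
  Equiv.prodShear σ ψ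

theorem shear_apply (σ : Equiv.Perm Q) (ψ : Q → Equiv.Perm N) (q : Q) (x : N) :
    shear σ ψ (q, x) = (σ q, ψ q x) := rfl

theorem sameCycle_shear_step (σ : Equiv.Perm Q) (ψ : Q → Equiv.Perm N) (q : Q) (x : N) :
    (shear σ ψ).SameCycle (q, x) (σ q, ψ q x) :=
  sameCycle_step _ (q, x)

variable [Finite Q] [Finite N]

/-- All twisting over this base cycle sits at `a`, so one tour of the base acts on the fibre as `ψ
a`. -/
theorem sameCycle_shear (σ : Equiv.Perm Q) (ψ : Q → Equiv.Perm N) (a : Q)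
    (h : ∀ q, σ.SameCycle a q → q ≠ a → ψ q = 1) {q q' : Q} (hq : σ.SameCycle a q)
    (hq' : σ.SameCycle a q') {x y : N} (hxy : (ψ a).SameCycle x y) :
    (shear σ ψ).SameCycle (q, x) (q', y) := by
  let S := Equiv.Perm.SameCycle.setoid (shear σ ψ)
  have cut : ∀ z : N, S (a, z) (σ a, z) := by
    intro z
    refine rel_of_cut σ (S.comap fun q => (q, z)) a ?_
    intro q hq hne
    have := sameCycle_shear_step σ ψ q z
    rwa [h q hq hne] at this
  have hor : ∀ (z : N) (q : Q), σ.SameCycle a q → S (a, z) (q, z) := by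
    intro z q hq
    refine rel_of_sameCycle σ (S.comap fun q => (q, z)) ?_ hq
    intro q hq
    by_cases hqa : q = a
    · rw [hqa]; exact cut z
    · have := sameCycle_shear_step σ ψ q z
      rwa [h q hq hqa] at this
  have hver : S (a, x) (a, y) := by
    refine rel_of_sameCycle (ψ a) (S.comap fun z => (a, z)) ?_ hxy
    intro z _
    exact S.trans (sameCycle_shear_step σ ψ a z) (S.symm (cut _))
  exact S.trans (S.symm (hor x q hq)) (S.trans hver (hor y q' hq'))

end Shear

/-! ### Skew products on a group extension -/

section Level

variable {K Q : Type*} [AddCommGroup K] [AddCommGroup Q]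

/-- Coordinates on an extension of `Q` given by a choice of coset representatives. -/
def levelEquiv (π : K →+ Q) (t : Q → K) (ht : ∀ q, π (t q) = q) : Q × π.ker ≃ K where
  toFun p := t p.1 + p.2
  invFun k := (π k, ⟨k - t (π k), by simp [AddMonoidHom.mem_ker, ht]⟩)
  left_inv := by
    rintro ⟨q, x, hx⟩
    have hx' : π x = 0 := hx
    ext
    · simp [ht, hx']
    · simp [ht, hx']
  right_inv k := by simp

variable (π : K →+ Q) (t : Q → K) (ht : ∀ q, π (t q) = q)

theorem levelEquiv_apply (q : Q) (x : π.ker) : levelEquiv π t ht (q, x) = t q + x := rfl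

theorem map_levelEquiv (p : Q × π.ker) : π (levelEquiv π t ht p) = p.1 := by
  obtain ⟨q, x, hx⟩ := p
  have hx' : π x = 0 := hx
  simp [levelEquiv_apply, ht, hx']

/-- The skew product of `σ` and `ψ` as a permutation of the extension. -/
def levelPerm (σ : Equiv.Perm Q) (ψ : Q → Equiv.Perm π.ker) : Equiv.Perm K :=
  (levelEquiv π t ht).permCongr (shear σ ψ)

theorem levelPerm_apply (σ : Equiv.Perm Q) (ψ : Q → Equiv.Perm π.ker) (p : Q × π.ker) :
    levelPerm π t ht σ ψ (levelEquiv π t ht p) = levelEquiv π t ht (shear σ ψ p) := by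
  simp [levelPerm, Equiv.permCongr_apply]

/-- The extension need not split: over `q` the sum is the constant `t q + t (σ q)` plus `x + ψ q x`,
so completeness of `σ` recovers the level and completeness of `ψ q` the fibre coordinate. -/
theorem isCompleteMapping_levelPerm [Finite K] {σ : Equiv.Perm Q} {ψ : Q → Equiv.Perm π.ker}
    (hσ : IsCompleteMapping σ) (hψ : ∀ q, IsCompleteMapping (ψ q)) :
    IsCompleteMapping (levelPerm π t ht σ ψ) := by
  apply Finite.injective_iff_bijective.1
  intro a b hab
  obtain ⟨⟨q, x⟩, rfl⟩ := (levelEquiv π t ht).surjective a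
  obtain ⟨⟨q', x'⟩, rfl⟩ := (levelEquiv π t ht).surjective b
  simp only [levelPerm_apply] at hab
  have h1 := congrArg π hab
  simp only [map_add, map_levelEquiv, shear_apply] at h1
  have h2 := hσ.1 h1
  subst h2
  simp only [levelEquiv_apply, shear_apply] at hab
  have h3 : x + ψ q x = x' + ψ q x' := by
    apply Subtype.ext
    push_cast
    have : (t q + t (σ q)) + ((x : K) + ψ q x) = (t q + t (σ q)) + ((x' : K) + ψ q x') := by
      calc _ = _ := by abel
        _ = _ := hab
        _ = _ := by abel
    exact add_left_cancel this
  rw [(hψ q).1 h3]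

variable [Finite K]

theorem sameCycle_levelPerm [Finite Q] {σ : Equiv.Perm Q} {ψ : Q → Equiv.Perm π.ker}
    {p p' : Q × π.ker} :
    (levelPerm π t ht σ ψ).SameCycle (levelEquiv π t ht p) (levelEquiv π t ht p') ↔
      (shear σ ψ).SameCycle p p' := by
  constructor
  · intro h
    have := sameCycle_map (g := shear σ ψ) (levelEquiv π t ht).symm (fun x => by
      obtain ⟨p, rfl⟩ := (levelEquiv π t ht).surjective x
      rw [levelPerm_apply]; simp) h
    simpa using this
  · intro h
    exact sameCycle_map (levelEquiv π t ht) (fun x => (levelPerm_apply π t ht σ ψ x).symm) h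

end Level

/-! ### Transport of splittability and extensions with odd cyclic kernel -/

theorem IsCompleteMapping.symm {K : Type*} [AddCommGroup K] {θ : Equiv.Perm K}
    (h : IsCompleteMapping θ) : IsCompleteMapping θ⁻¹ := by
  have : (fun x => x + θ⁻¹ x) = (fun x => x + θ x) ∘ (θ⁻¹ : Equiv.Perm K) := by
    funext x
    simp [add_comm]
  unfold IsCompleteMapping
  rw [this]
  exact h.comp (θ⁻¹).bijective

theorem IsSplittable.of_addEquiv {K L : Type*} [AddCommGroup K] [AddCommGroup L] [Finite K]
    (e : K ≃+ L) (h : IsSplittable K) : IsSplittable L := by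
  have : Finite L := Finite.of_equiv K e.toEquiv
  have conj : ∀ f : Equiv.Perm K, IsCompleteMapping f →
      IsCompleteMapping (e.toEquiv.permCongr f) := by
    intro f hf
    have : (fun x => x + e.toEquiv.permCongr f x) = e ∘ (fun x => x + f x) ∘ e.symm := by
      funext x
      simp [Equiv.permCongr_apply]
    unfold IsCompleteMapping
    rw [this]
    exact e.bijective.comp (hf.comp e.symm.bijective)
  have fwd : ∀ (f : Equiv.Perm K) {x y : K}, f.SameCycle x y →
      (e.toEquiv.permCongr f).SameCycle (e x) (e y) := fun f x y h =>
    sameCycle_map e (fun x => by simp [Equiv.permCongr_apply]) h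
  have bwd : ∀ (f : Equiv.Perm K) {x y : K}, (e.toEquiv.permCongr f).SameCycle (e x) (e y) →
      f.SameCycle x y := fun f x y h => by
    have := sameCycle_map (g := f) e.symm (fun x => by simp [Equiv.permCongr_apply]) h
    simpa using this
  obtain ⟨θ, G, hθ, hG, hc, u, hne, hall⟩ := h
  have h2 : e.toEquiv.permCongr θ (e.toEquiv.permCongr θ (e u)) = e (θ (θ u)) := by
    simp [Equiv.permCongr_apply]
  refine ⟨e.toEquiv.permCongr θ, e.toEquiv.permCongr G, conj θ hθ, conj G hG, ?_, e u, ?_, ?_⟩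
  · intro x y
    obtain ⟨x, rfl⟩ := e.surjective x
    obtain ⟨y, rfl⟩ := e.surjective y
    exact fwd θ (hc x y)
  · rw [h2]; exact fun h => hne (bwd G h)
  · intro x
    obtain ⟨x, rfl⟩ := e.surjective x
    rw [h2]
    exact (hall x).imp (fwd G) (fwd G)

/-- The sum is `2x + c`, and doubling is injective in odd order. -/
theorem isCompleteMapping_addRight {N : Type*} [AddCommGroup N] [Finite N]
    (hN : Odd (Nat.card N)) (c : N) : IsCompleteMapping (Equiv.addRight c) := by
  apply Finite.injective_iff_bijective.1
  intro x y hxy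
  have h1 : (2 : ℕ) • (x - y) = 0 := by
    have h0 : x + (x + c) = y + (y + c) := hxy
    have : x + (x + c) - (y + (y + c)) = 0 := by rw [h0, sub_self]
    rw [two_nsmul, ← this]; abel
  have h2 : addOrderOf (x - y) ∣ 2 := addOrderOf_dvd_of_nsmul_eq_zero h1
  have h3 : addOrderOf (x - y) ∣ Nat.card N := addOrderOf_dvd_natCard (x - y)
  have h4 : addOrderOf (x - y) ∣ 1 := by
    have := Nat.dvd_gcd h2 h3
    rwa [Nat.Coprime.gcd_eq_one (Nat.coprime_two_left.2 hN)] at this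
  exact sub_eq_zero.1 (AddMonoid.addOrderOf_eq_one_iff.1 (Nat.dvd_one.1 h4))

theorem sameCycle_addRight {N : Type*} [AddCommGroup N] (g : N)
    (hg : ∀ x, x ∈ AddSubgroup.zmultiples g) (x y : N) : (Equiv.addRight g).SameCycle x y := by
  obtain ⟨k, hk⟩ := AddSubgroup.mem_zmultiples_iff.1 (hg (y - x))
  have key : ∀ k : ℤ, (Equiv.addRight g ^ k) x = x + k • g := by
    intro k
    induction k with
    | zero => simp
    | succ k ih => rw [add_comm, zpow_add, Equiv.Perm.mul_apply, ih]; simp [add_smul]; abel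
    | pred k ih =>
      rw [sub_eq_neg_add, zpow_add, Equiv.Perm.mul_apply, ih, zpow_neg_one,
        Equiv.Perm.inv_eq_iff_eq]
      simp [add_smul]; abel
  exact ⟨k, by rw [key, hk]; abel⟩

/-- Extensions by a cyclic group of odd order preserve splittability. -/
theorem IsSplittable.of_cyclic_odd_ker {K Q : Type*} [AddCommGroup K] [AddCommGroup Q] [Finite K]
    [Finite Q] (π : K →+ Q) (hπ : Function.Surjective π) (hodd : Odd (Nat.card π.ker))
    (g : π.ker) (hg : ∀ x, x ∈ AddSubgroup.zmultiples g) (h : IsSplittable Q) :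
    IsSplittable K := by
  classical
  obtain ⟨θ, G, hθ, hG, hc, u, hne, hall⟩ := h
  let t := Function.surjInv hπ
  have ht : ∀ q, π (t q) = q := Function.surjInv_eq hπ
  -- Exactly one twist by the generator on each base cycle: at `u` for `θ`, and at `u` and `θ (θ
  -- u)`, which lie on different cycles, for `G`. Every base cycle thus lifts to one cycle.
  let ψ : Q → Equiv.Perm π.ker := fun q => Equiv.addRight (if q = u then g else 0)
  let χ : Q → Equiv.Perm π.ker := fun q =>
    Equiv.addRight (if q = u ∨ q = θ (θ u) then g else 0)
  have one : Equiv.addRight (0 : π.ker) = 1 := by ext; simp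
  let E := levelEquiv π t ht
  let Θ := levelPerm π t ht θ ψ
  have hΘ : Θ (Θ (E (u, 0))) = E (θ (θ u), ψ (θ u) (ψ u 0)) := by
    simp only [Θ, E, levelPerm_apply, shear_apply]
  refine ⟨Θ, levelPerm π t ht G χ,
    isCompleteMapping_levelPerm π t ht hθ fun q => isCompleteMapping_addRight hodd _,
    isCompleteMapping_levelPerm π t ht hG fun q => isCompleteMapping_addRight hodd _, ?_,
    E (u, 0), ?_, ?_⟩
  · intro x y
    obtain ⟨⟨q, x⟩, rfl⟩ := E.surjective x
    obtain ⟨⟨q', y⟩, rfl⟩ := E.surjective y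
    rw [sameCycle_levelPerm]
    apply sameCycle_shear θ ψ u _ (hc _ _) (hc _ _)
    · simp only [ψ, if_true]
      exact sameCycle_addRight g hg x y
    · intro q _ hq
      simp only [ψ, if_neg hq, one]
  · rw [hΘ, sameCycle_levelPerm]
    intro hs
    exact hne (sameCycle_map (g := G) Prod.fst (fun p => rfl) hs)
  · intro x
    obtain ⟨⟨q, x⟩, rfl⟩ := E.surjective x
    rw [hΘ, sameCycle_levelPerm, sameCycle_levelPerm]
    rcases hall q with hq | hq
    · left
      apply sameCycle_shear G χ u _ (Equiv.Perm.SameCycle.refl _ _) hq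
      · simp only [χ, true_or, if_true]
        exact sameCycle_addRight g hg _ _
      · intro q' hq' hne'
        have : q' ≠ θ (θ u) := fun hh => hne (hh ▸ hq')
        simp only [χ, hne', this, or_self, if_false, one]
    · right
      apply sameCycle_shear G χ (θ (θ u)) _ (Equiv.Perm.SameCycle.refl _ _) hq
      · simp only [χ, or_true, if_true]
        exact sameCycle_addRight g hg _ _
      · intro q' hq' hne'
        have : q' ≠ u := fun hh => hne (hh ▸ hq').symm
        simp only [χ, hne', this, or_self, if_false, one]

/-! ### Merging three cycles of a complete mapping -/

section Splice

variable {K : Type*} [AddCommGroup K] [Finite K]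

/-- The combination of `splice` with the exchange of four images. -/
theorem exists_spliced {f : Equiv.Perm K} (hf : IsCompleteMapping f) (R : Fin 4 → K)
    (hR : Function.Injective R)
    (e0 : R 0 + f (R 3) = R 2 + f (R 2)) (e1 : R 1 + f (R 2) = R 3 + f (R 3))
    (e2 : R 2 + f (R 1) = R 0 + f (R 0)) (e3 : R 3 + f (R 0) = R 1 + f (R 1))
    (hcov : ∀ x, f.SameCycle (R 0) x ∨ f.SameCycle (R 1) x ∨ f.SameCycle (R 2) x)
    (h01 : ¬ f.SameCycle (R 0) (R 1)) (h02 : ¬ f.SameCycle (R 0) (R 2))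
    (h12 : ¬ f.SameCycle (R 1) (R 2)) (h03 : ¬ f.SameCycle (R 0) (R 3)) :
    ∃ g : Equiv.Perm K, IsCompleteMapping g ∧ (∀ x y, g.SameCycle x y) ∧ g (R 0) = f (R 3) ∧
      ∀ x, x ∉ Set.range R → g x = f x := by
  obtain ⟨g, hg, hgR, hgo, -⟩ := hf.exists_trade ⟨R, hR⟩
    (Equiv.swap 0 3 * Equiv.swap 1 2) (Equiv.swap 0 2 * Equiv.swap 1 3) (by
      intro i
      fin_cases i
      exacts [e0, e1, e2, e3])
  have s0 : (Equiv.swap 0 3 * Equiv.swap 1 2 : Equiv.Perm (Fin 4)) 0 = 3 := by decide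
  have s1 : (Equiv.swap 0 3 * Equiv.swap 1 2 : Equiv.Perm (Fin 4)) 1 = 2 := by decide
  have s2 : (Equiv.swap 0 3 * Equiv.swap 1 2 : Equiv.Perm (Fin 4)) 2 = 1 := by decide
  have s3 : (Equiv.swap 0 3 * Equiv.swap 1 2 : Equiv.Perm (Fin 4)) 3 = 0 := by decide
  have r0 : g (R 0) = f (R 3) := by simpa [s0] using hgR 0
  have r1 : g (R 1) = f (R 2) := by simpa [s1] using hgR 1
  have r3 : g (R 3) = f (R 0) := by simpa [s3] using hgR 3
  refine ⟨g, hg, ?_, r0, hgo⟩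
  apply splice f g (R 0) (R 1) (R 2) (R 3) hcov h01 h02 h12 h03 r0 r1 r3
  intro x h0 h1 h2 h3
  apply hgo
  rintro ⟨i, rfl⟩
  fin_cases i
  exacts [h0 rfl, h1 rfl, h2 rfl, h3 rfl]

end Splice

/-! ### Extensions of the Klein four-group -/

theorem perm_inv_apply_self {α : Type*} (f : Equiv.Perm α) (x : α) : f⁻¹ (f x) = x :=
  f.symm_apply_apply x

theorem perm_apply_inv_self {α : Type*} (f : Equiv.Perm α) (x : α) : f (f⁻¹ x) = x :=
  f.apply_symm_apply x

/-- A complete mapping of the Klein four-group with one fixed point. -/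
def kleinPerm : Equiv.Perm (ZMod 2 × ZMod 2) where
  toFun p := (p.2, p.1 + p.2)
  invFun p := (p.1 + p.2, p.1)
  left_inv := by unfold Function.LeftInverse; decide
  right_inv := by unfold Function.RightInverse Function.LeftInverse; decide

theorem isCompleteMapping_kleinPerm : IsCompleteMapping kleinPerm := by
  apply Finite.injective_iff_bijective.1
  unfold Function.Injective
  decide

section Klein

variable {N : Type*}

/-- A family of four permutations indexed by the Klein four-group. -/
def kleinFamily (ψ₀ ψ₁ ψ₂ ψ₃ : Equiv.Perm N) (q : ZMod 2 × ZMod 2) : Equiv.Perm N :=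
  if q = (0, 0) then ψ₀ else if q = (1, 0) then ψ₁ else if q = (0, 1) then ψ₂ else ψ₃

theorem forall_klein {P : ZMod 2 × ZMod 2 → Prop} (h0 : P (0, 0)) (h1 : P (1, 0)) (h2 : P (0, 1))
    (h3 : P (1, 1)) (q : ZMod 2 × ZMod 2) : P q := by
  have : q = (0, 0) ∨ q = (1, 0) ∨ q = (0, 1) ∨ q = (1, 1) := by revert q; decide
  rcases this with rfl | rfl | rfl | rfl <;> assumption

variable (ψ₀ ψ₁ ψ₂ ψ₃ : Equiv.Perm N)

theorem shear_klein_step1 (x : N) :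
    (shear kleinPerm (kleinFamily ψ₀ ψ₁ ψ₂ ψ₃)).SameCycle ((1, 0), x) ((0, 1), ψ₁ x) :=
  sameCycle_step _ ((1, 0), x)

theorem shear_klein_step2 (x : N) :
    (shear kleinPerm (kleinFamily ψ₀ ψ₁ ψ₂ ψ₃)).SameCycle ((0, 1), x) ((1, 1), ψ₂ x) :=
  sameCycle_step _ ((0, 1), x)

theorem shear_klein_step3 (x : N) :
    (shear kleinPerm (kleinFamily ψ₀ ψ₁ ψ₂ ψ₃)).SameCycle ((1, 1), x) ((1, 0), ψ₃ x) :=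
  sameCycle_step _ ((1, 1), x)

variable [Finite N]

theorem shear_klein_zero {x y : N} (h : ψ₀.SameCycle x y) :
    (shear kleinPerm (kleinFamily ψ₀ ψ₁ ψ₂ ψ₃)).SameCycle ((0, 0), x) ((0, 0), y) :=
  sameCycle_map (fun x => (((0, 0), x) : (ZMod 2 × ZMod 2) × N)) (fun _ => rfl) h

/-- `kleinPerm` rotates the three nonzero levels; the product is the first return map to level `(1,
0)`. -/
theorem shear_klein_return {x y : N} (h : (ψ₃ * ψ₂ * ψ₁).SameCycle x y) :
    (shear kleinPerm (kleinFamily ψ₀ ψ₁ ψ₂ ψ₃)).SameCycle ((1, 0), x) ((1, 0), y) := by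
  let S := Equiv.Perm.SameCycle.setoid (shear kleinPerm (kleinFamily ψ₀ ψ₁ ψ₂ ψ₃))
  refine rel_of_sameCycle _ (S.comap fun x => (((1, 0), x) : (ZMod 2 × ZMod 2) × N)) ?_ h
  intro x _
  exact S.trans (shear_klein_step1 ψ₀ ψ₁ ψ₂ ψ₃ x)
    (S.trans (shear_klein_step2 ψ₀ ψ₁ ψ₂ ψ₃ _) (shear_klein_step3 ψ₀ ψ₁ ψ₂ ψ₃ _))

theorem not_shear_klein_zero {q : ZMod 2 × ZMod 2} (hq : q ≠ (0, 0)) (x y : N) :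
    ¬ (shear kleinPerm (kleinFamily ψ₀ ψ₁ ψ₂ ψ₃)).SameCycle ((0, 0), x) (q, y) := by
  intro h
  have := sameCycle_map (g := kleinPerm) Prod.fst (fun p => rfl) h
  have := mem_of_sameCycle kleinPerm {(0, 0)} (by rintro x rfl; rfl) this rfl
  exact hq this

end Klein

/-- Extensions of the Klein four-group by a splittable group are splittable. -/
theorem IsSplittable.of_klein_quotient {K : Type*} [AddCommGroup K] [Finite K]
    (π : K →+ ZMod 2 × ZMod 2) (hπ : Function.Surjective π) (h : IsSplittable π.ker) :
    IsSplittable K := by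
  classical
  obtain ⟨θ, G, hθ, hG, hc, u, hne, hall⟩ := h
  obtain ⟨t₂, ht₂⟩ := hπ (0, 1)
  obtain ⟨t₃, ht₃⟩ := hπ (1, 1)
  have h22 : t₂ + t₂ ∈ π.ker := by
    rw [AddMonoidHom.mem_ker, map_add, ht₂]; decide
  -- Chosen to satisfy `R 2 + f (R 1) = R 0 + f (R 0)` for the four points `R` below; solvable
  -- because `θ` is complete.
  obtain ⟨u₀, hu₀⟩ := hθ.2 (⟨t₂ + t₂, h22⟩ + G u + θ (θ u))
  have hu₀' : (u₀ : K) + θ u₀ = t₂ + t₂ + G u + θ (θ u) := by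
    have := congrArg (Subtype.val) hu₀
    simpa using this
  have k1 : ((1, 0) : ZMod 2 × ZMod 2) ≠ (0, 0) := by decide
  have k2 : ((0, 1) : ZMod 2 × ZMod 2) ≠ (0, 0) := by decide
  have k3 : ((1, 1) : ZMod 2 × ZMod 2) ≠ (0, 0) := by decide
  have hker : ∀ x : π.ker, π x = 0 := fun x => x.2
  -- The representative of `(1, 0)` is forced by `R 3 + f (R 0) = R 1 + f (R 1)`. The identity for
  -- `R 1 + f (R 2)` holds for any representatives, since `θ⁻¹` takes `θ (θ u)` to `θ u`, the fibre
  -- coordinate of `f (R 3)`; this is why `IsSplittable` involves `θ (θ u)`. The fourth identity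
  -- follows from these choices.
  let t₁ : K := t₃ + θ u₀ - t₂ - G u
  have ht₁ : π t₁ = (1, 0) := by
    simp only [t₁, map_sub, map_add, ht₂, ht₃, hker]; decide
  let t : ZMod 2 × ZMod 2 → K := fun q =>
    if q = (0, 0) then 0 else if q = (1, 0) then t₁ else if q = (0, 1) then t₂ else t₃
  have ht : ∀ q, π (t q) = q := forall_klein (by simp [t]; rfl) (by simp [t, ht₁]) (by simp [t, ht₂])
    (by simp [t, ht₃])
  let E := levelEquiv π t ht
  have E0 : ∀ x, E ((0, 0), x) = x := fun x => by simp [E, levelEquiv_apply, t]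
  have E1 : ∀ x, E ((1, 0), x) = t₁ + x := fun x => by simp [E, levelEquiv_apply, t]
  have E2 : ∀ x, E ((0, 1), x) = t₂ + x := fun x => by simp [E, levelEquiv_apply, t]
  have E3 : ∀ x, E ((1, 1), x) = t₃ + x := fun x => by simp [E, levelEquiv_apply, t]
  -- The first return map to level `(1, 0)` is `θ * θ⁻¹ * G = G`, giving two cycles off the zero
  -- level, besides the single cycle of `θ` on it.
  let ψ := kleinFamily θ G θ⁻¹ θ
  let f := levelPerm π t ht kleinPerm ψ
  have hf : IsCompleteMapping f := by
    refine isCompleteMapping_levelPerm π t ht isCompleteMapping_kleinPerm ?_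
    exact forall_klein hθ hG hθ.symm hθ
  let R : Fin 4 → K :=
    ![E ((0, 0), u₀), E ((1, 0), u), E ((0, 1), θ (θ u)), E ((1, 1), u)]
  have hR : Function.Injective R := by
    intro i j hij
    have hp : ∀ i, π (R i) = ![(0, 0), (1, 0), (0, 1), (1, 1)] i := by
      intro i
      fin_cases i <;> exact map_levelEquiv π t ht _
    have h1 := congrArg π hij
    rw [hp, hp] at h1
    revert i j
    have : Function.Injective (![(0, 0), (1, 0), (0, 1), (1, 1)] : Fin 4 → ZMod 2 × ZMod 2) := by
      unfold Function.Injective; decide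
    intro i j _ h1
    exact this h1
  have fR : ∀ p, f (E p) = E (shear kleinPerm ψ p) := levelPerm_apply π t ht kleinPerm ψ
  have fR0 : f (R 0) = E ((0, 0), θ u₀) := fR _
  have fR1 : f (R 1) = E ((0, 1), G u) := fR _
  have fR2 : f (R 2) = E ((1, 1), θ u) := by
    have : f (R 2) = E ((1, 1), θ⁻¹ (θ (θ u))) := fR _
    rw [this, perm_inv_apply_self]
  have fR3 : f (R 3) = E ((1, 0), θ u) := fR _
  have hsc : ∀ p p', f.SameCycle (E p) (E p') ↔ (shear kleinPerm ψ).SameCycle p p' :=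
    fun p p' => sameCycle_levelPerm π t ht
  have n0 : ∀ q, q ≠ (0, 0) → ∀ x, ¬ f.SameCycle (R 0) (E (q, x)) := fun q hq x h =>
    not_shear_klein_zero θ G θ⁻¹ θ hq u₀ x ((hsc _ _).1 h)
  have hret : θ * θ⁻¹ * G = G := by group
  -- every element off the zero level is equivalent to one over `(1, 0)`
  have base : ∀ q, q ≠ (0, 0) → ∀ x, ∃ y, (shear kleinPerm ψ).SameCycle ((1, 0), y) (q, x) := by
    refine forall_klein (fun h => absurd rfl h) (fun _ x => ⟨x, Equiv.Perm.SameCycle.refl _ _⟩)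
      (fun _ x => ⟨G⁻¹ x, ?_⟩) (fun _ x => ⟨θ x, ?_⟩)
    · have := shear_klein_step1 θ G θ⁻¹ θ (G⁻¹ x)
      rwa [perm_apply_inv_self] at this
    · exact (shear_klein_step3 θ G θ⁻¹ θ x).symm
  have top2 : (shear kleinPerm ψ).SameCycle ((1, 0), θ (θ u)) ((0, 1), θ (θ u)) := by
    have a1 := shear_klein_step2 θ G θ⁻¹ θ (θ (θ u))
    rw [perm_inv_apply_self] at a1
    exact (a1.trans (shear_klein_step3 θ G θ⁻¹ θ (θ u))).symm
  have hcov : ∀ x, f.SameCycle (R 0) x ∨ f.SameCycle (R 1) x ∨ f.SameCycle (R 2) x := by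
    intro k
    obtain ⟨⟨q, x⟩, rfl⟩ := E.surjective k
    by_cases hq : q = (0, 0)
    · left
      subst hq
      exact (hsc _ _).2 (shear_klein_zero θ G θ⁻¹ θ (hc _ _))
    · right
      obtain ⟨y, hy⟩ := base q hq x
      rcases hall y with h | h
      · left
        exact (hsc _ _).2 ((shear_klein_return θ G θ⁻¹ θ (by rwa [hret])).trans hy)
      · right
        exact (hsc _ _).2 (top2.symm.trans
          ((shear_klein_return θ G θ⁻¹ θ (by rwa [hret])).trans hy))
  have h12 : ¬ f.SameCycle (R 1) (R 2) := by
    intro h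
    have h1 : (shear kleinPerm ψ).SameCycle ((1, 0), u) ((1, 0), θ (θ u)) :=
      ((hsc _ _).1 h).trans top2.symm
    -- Invariance needs the coordinate over `(1, 1)` to be corrected by `θ`, which undoes the
    -- preceding `θ⁻¹`; the `G`-cycle of the corrected coordinate never changes.
    let S : Set ((ZMod 2 × ZMod 2) × π.ker) := fun p =>
      G.SameCycle u (if p.1 = (1, 1) then θ p.2 else p.2) ∧ p.1 ≠ (0, 0)
    have hS : ∀ p ∈ S, shear kleinPerm ψ p ∈ S := by
      rintro ⟨q, x⟩
      revert q
      refine forall_klein (fun h => absurd rfl h.2) ?_ ?_ ?_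
      · rintro ⟨h, -⟩
        exact ⟨h.trans (sameCycle_step G x), k2⟩
      · rintro ⟨h, -⟩
        refine ⟨?_, k3⟩
        change G.SameCycle u (θ (θ⁻¹ x))
        rw [perm_apply_inv_self]; exact h
      · rintro ⟨h, -⟩
        exact ⟨h, k1⟩
    exact hne (mem_of_sameCycle _ S hS h1 ⟨Equiv.Perm.SameCycle.refl _ _, k1⟩).1
  obtain ⟨g, hg, hgc, hg0, hgo⟩ := exists_spliced hf R hR
    (by
      rw [fR3, fR2]
      change E _ + _ = E _ + _
      rw [E0, E1, E2, E3]
      have : (u₀ : K) + (t₁ + θ u) = (u₀ + θ u₀) + t₃ - t₂ - G u + θ u := by simp only [t₁]; abel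
      rw [this, hu₀']; abel)
    (by
      rw [fR3, fR2]
      change E _ + _ = E _ + _
      simp only [E1, E3]; abel)
    (by
      rw [fR1, fR0]
      change E _ + _ = E _ + _
      rw [E0, E0, E2, E2, hu₀']; abel)
    (by
      rw [fR1, fR0]
      change E _ + _ = E _ + _
      rw [E0, E1, E2, E3]; simp only [t₁]; abel)
    hcov (n0 _ (by decide) _) (n0 _ (by decide) _) h12 (n0 _ (by decide) _)
  -- The two-cycle mapping for `K`: the return map is now `θ⁻¹ * θ * θ = θ`, so the cycles are the
  -- zero level and its complement.
  let χ := kleinFamily θ θ θ θ⁻¹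
  let F := levelPerm π t ht kleinPerm χ
  have hsF : ∀ p p', F.SameCycle (E p) (E p') ↔ (shear kleinPerm χ).SameCycle p p' :=
    fun p p' => sameCycle_levelPerm π t ht
  have hu : θ (θ⁻¹ u₀) = u₀ := perm_apply_inv_self _ _
  -- A fixed point of the single cycle `θ` would leave only one element, hence no room for two
  -- cycles of `G`.
  have hfix : θ⁻¹ u₀ ≠ u₀ := by
    intro h
    have hf : θ u₀ = u₀ := by rw [← h, hu, h]
    have hsub : u = u₀ := mem_of_sameCycle θ {u₀}
      (fun x hx => by rw [Set.mem_singleton_iff.1 hx]; exact hf) (hc u₀ u) rfl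
    exact hne (by rw [hsub, hf, hf])
  -- The new base point precedes `R 0`: its first step stays on the zero level, and the second
  -- leaves it by the redirected arrow, so the second iterate lies on the other cycle of `F`.
  have g1 : g (E ((0, 0), θ⁻¹ u₀)) = R 0 := by
    rw [hgo, fR]
    · change E ((0, 0), θ (θ⁻¹ u₀)) = _
      rw [hu]; rfl
    · rintro ⟨i, hi⟩
      have h1 := E.injective (a₁ := (![((0, 0), u₀), ((1, 0), u), ((0, 1), θ (θ u)), ((1, 1), u)] :
        Fin 4 → (ZMod 2 × ZMod 2) × π.ker) i) (a₂ := ((0, 0), θ⁻¹ u₀)) (by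
          rw [← hi]; fin_cases i <;> rfl)
      fin_cases i
      · exact hfix (congrArg Prod.snd h1).symm
      exacts [k1 (congrArg Prod.fst h1), k2 (congrArg Prod.fst h1), k3 (congrArg Prod.fst h1)]
  have g2 : g (g (E ((0, 0), θ⁻¹ u₀))) = E ((1, 0), θ u) := by rw [g1, hg0, fR3]
  refine ⟨g, F, hg, ?_, hgc, E ((0, 0), θ⁻¹ u₀), ?_, ?_⟩
  · refine isCompleteMapping_levelPerm π t ht isCompleteMapping_kleinPerm ?_
    exact forall_klein hθ hθ hθ hθ.symm
  · rw [g2, hsF]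
    exact not_shear_klein_zero θ θ θ θ⁻¹ (by decide) _ _
  · intro k
    rw [g2]
    obtain ⟨⟨q, x⟩, rfl⟩ := E.surjective k
    rw [hsF, hsF]
    by_cases hq : q = (0, 0)
    · left
      subst hq
      exact shear_klein_zero θ θ θ θ⁻¹ (hc _ _)
    · right
      have hret : θ⁻¹ * θ * θ = θ := by group
      have hr : ∀ x y, (shear kleinPerm χ).SameCycle ((1, 0), x) ((1, 0), y) := fun x y =>
        shear_klein_return θ θ θ θ⁻¹ (by rw [hret]; exact hc x y)
      revert q
      refine forall_klein (fun h => absurd rfl h) (fun _ => hr _ _) (fun _ => ?_) (fun _ => ?_)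
      · have := shear_klein_step1 θ θ θ θ⁻¹ (θ⁻¹ x)
        rw [perm_apply_inv_self] at this
        exact (hr _ _).trans this
      · exact (hr _ _).trans (shear_klein_step3 θ θ θ θ⁻¹ x).symm

/-! ### Groups of prime order -/

/-- Groups of prime order at least `5` are splittable. -/
theorem isSplittable_zmod_prime (p : ℕ) [hp : Fact p.Prime] (h5 : 5 ≤ p) :
    IsSplittable (ZMod p) := by
  have hodd : Odd (Nat.card (ZMod p)) := by
    rw [Nat.card_zmod]
    exact hp.out.odd_of_ne_two (by omega)
  -- Multiplication by a primitive root has the cycles `{0}` and the units, and its sum map is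
  -- multiplication by `1 + g`. That factor is nonzero because `-1` has order at most 2, less than
  -- `p - 1`.
  obtain ⟨g, hg⟩ := IsCyclic.exists_generator (α := (ZMod p)ˣ)
  have h2 : (2 : ZMod p) ≠ 0 := by
    intro h
    have : ((2 : ℕ) : ZMod p) = 0 := by exact_mod_cast h
    exact absurd (Nat.le_of_dvd (by norm_num) ((ZMod.natCast_eq_zero_iff 2 p).1 this)) (by omega)
  have hg1 : (1 : ZMod p) + g ≠ 0 := by
    intro h
    have hgn : g = -1 := by
      ext; push_cast; linear_combination h
    have hord : orderOf g ∣ 2 := by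
      apply orderOf_dvd_of_pow_eq_one
      rw [hgn]; simp
    have hc : orderOf g = p - 1 := by
      rw [orderOf_eq_card_of_forall_mem_zpowers hg, Nat.card_eq_fintype_card,
        ZMod.card_units_eq_totient, Nat.totient_prime hp.out]
    rw [hc] at hord
    exact absurd (Nat.le_of_dvd (by norm_num) hord) (by omega)
  let G : Equiv.Perm (ZMod p) := Equiv.mulLeft₀ (g : ZMod p) g.ne_zero
  have hG : ∀ x, G x = g * x := fun _ => rfl
  let v : (ZMod p)ˣ := Units.mk0 2 h2
  have hadd : ∀ x, (Equiv.addRight (1 : ZMod p)) x = x + 1 := fun _ => rfl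
  have hv : Equiv.addRight (1 : ZMod p) (Equiv.addRight (1 : ZMod p) 0) = v := by
    rw [hadd, hadd, Units.val_mk0]; norm_num
  refine ⟨Equiv.addRight 1, G, isCompleteMapping_addRight hodd 1, ?_,
    sameCycle_addRight 1 ?_, 0, ?_, ?_⟩
  · apply Finite.injective_iff_bijective.1
    intro x y hxy
    have : (1 + (g : ZMod p)) * x = (1 + g) * y := by
      have : x + g * x = y + g * y := hxy
      linear_combination this
    exact mul_left_cancel₀ hg1 this
  · intro x
    exact AddSubgroup.mem_zmultiples_iff.2 ⟨x.val, by simp⟩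
  · intro h
    rw [hv] at h
    have := mem_of_sameCycle G {0} (fun x hx => by
      rw [Set.mem_singleton_iff.1 hx, hG, mul_zero]; rfl) h rfl
    exact v.ne_zero this
  · intro x
    rw [hv]
    by_cases hx : x = 0
    · left; rw [hx]
    · right
      obtain ⟨k, hk⟩ := hg (Units.mk0 x hx * v⁻¹)
      have key : ∀ k : ℤ, ∀ w : (ZMod p)ˣ, (G ^ k) w = (g ^ k * w : (ZMod p)ˣ) := by
        intro k
        induction k with
        | zero => simp
        | succ k ih =>
          intro w
          rw [add_comm, zpow_add, Equiv.Perm.mul_apply, ih, zpow_one, hG, zpow_add, zpow_one,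
            mul_assoc, Units.val_mul (g : (ZMod p)ˣ)]
        | pred k ih =>
          intro w
          rw [sub_eq_neg_add, zpow_add, Equiv.Perm.mul_apply, ih, zpow_neg_one,
            Equiv.Perm.inv_eq_iff_eq, hG, ← Units.val_mul]
          congr 1
          rw [← mul_assoc, zpow_add, zpow_neg_one, ← mul_assoc, mul_inv_cancel, one_mul]
      have hk' : g ^ k = Units.mk0 x hx * v⁻¹ := hk
      exact ⟨k, by rw [key, hk']; simp⟩

/-! ### Extensions of the elementary abelian group of order eight -/

/-- A complete mapping of the elementary abelian group of order eight with one fixed point and a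
cycle of length seven. -/
def octoPerm : Equiv.Perm (ZMod 2 × ZMod 2 × ZMod 2) where
  toFun p := (p.2.2, p.1 + p.2.2, p.2.1)
  invFun p := (p.1 + p.2.1, p.2.2, p.1)
  left_inv := by unfold Function.LeftInverse; decide
  right_inv := by unfold Function.RightInverse Function.LeftInverse; decide

theorem isCompleteMapping_octoPerm : IsCompleteMapping octoPerm := by
  apply Finite.injective_iff_bijective.1
  unfold Function.Injective
  decide

theorem sameCycle_octoPerm (q : ZMod 2 × ZMod 2 × ZMod 2) (hq : q ≠ 0) :
    octoPerm.SameCycle (1, 0, 1) q := by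
  have : ∀ q : ZMod 2 × ZMod 2 × ZMod 2, q ≠ 0 → ∃ k : Fin 7, (octoPerm ^ k.1) (1, 0, 1) = q := by
    decide
  obtain ⟨k, hk⟩ := this q hq
  exact ⟨k.1, by rw [zpow_natCast]; exact hk⟩

theorem not_sameCycle_octoPerm {q : ZMod 2 × ZMod 2 × ZMod 2} (hq : q ≠ 0) :
    ¬ octoPerm.SameCycle 0 q := by
  intro h
  exact hq (mem_of_sameCycle octoPerm {0} (by rintro x rfl; rfl) h rfl)

theorem isCompleteMapping_one {N : Type*} [AddCommGroup N] [Finite N] (hN : Odd (Nat.card N)) :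
    IsCompleteMapping (1 : Equiv.Perm N) := by
  have : Equiv.addRight (0 : N) = 1 := by ext; simp
  rw [← this]
  exact isCompleteMapping_addRight hN 0

section Octo

variable {N : Type*}

/-- A family of permutations indexed by the elementary abelian group of order eight that is
trivial outside two indices. -/
def octoFamily (ψ χ : Equiv.Perm N) (q : ZMod 2 × ZMod 2 × ZMod 2) : Equiv.Perm N :=
  if q = 0 then ψ else if q = (1, 0, 1) then χ else 1

variable (ψ χ : Equiv.Perm N) [Finite N]

theorem shear_octo_zero {x y : N} (h : ψ.SameCycle x y) :
    (shear octoPerm (octoFamily ψ χ)).SameCycle (0, x) (0, y) :=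
  sameCycle_map (fun x => ((0, x) : (ZMod 2 × ZMod 2 × ZMod 2) × N)) (fun _ => rfl) h

theorem shear_octo {q q' : ZMod 2 × ZMod 2 × ZMod 2} (hq : q ≠ 0) (hq' : q' ≠ 0) {x y : N}
    (h : χ.SameCycle x y) : (shear octoPerm (octoFamily ψ χ)).SameCycle (q, x) (q', y) := by
  apply sameCycle_shear octoPerm (octoFamily ψ χ) (1, 0, 1) _ (sameCycle_octoPerm q hq)
    (sameCycle_octoPerm q' hq')
  · have : ((1, 0, 1) : ZMod 2 × ZMod 2 × ZMod 2) ≠ 0 := by decide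
    simpa [octoFamily, this] using h
  · intro q hq hne
    have h0 : q ≠ 0 := fun h => not_sameCycle_octoPerm (q := (1, 0, 1)) (by decide) (h ▸ hq).symm
    simp only [octoFamily, h0, hne, if_false]

theorem not_shear_octo_zero {q : ZMod 2 × ZMod 2 × ZMod 2} (hq : q ≠ 0) (x y : N) :
    ¬ (shear octoPerm (octoFamily ψ χ)).SameCycle (0, x) (q, y) := fun h =>
  not_sameCycle_octoPerm hq (sameCycle_map (g := octoPerm) Prod.fst (fun _ => rfl) h)

theorem of_shear_octo {q q' : ZMod 2 × ZMod 2 × ZMod 2} (hq : q ≠ 0) {x y : N}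
    (h : (shear octoPerm (octoFamily ψ χ)).SameCycle (q, x) (q', y)) : χ.SameCycle x y := by
  let S : Set ((ZMod 2 × ZMod 2 × ZMod 2) × N) := fun p => χ.SameCycle x p.2 ∧ p.1 ≠ 0
  have hS : ∀ p ∈ S, shear octoPerm (octoFamily ψ χ) p ∈ S := by
    rintro ⟨r, z⟩ ⟨h1, h2⟩
    refine ⟨?_, ?_⟩
    · by_cases hr : r = (1, 0, 1)
      · subst hr
        exact h1.trans (sameCycle_step χ z)
      · have : (shear octoPerm (octoFamily ψ χ) (r, z)).2 = z := by
          have h2' : r ≠ 0 := h2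
          simp [shear_apply, octoFamily, hr, h2']
        rw [this]; exact h1
    · intro h0
      exact h2 (octoPerm.injective (h0.trans (by decide)))
  exact (mem_of_sameCycle _ S hS h ⟨Equiv.Perm.SameCycle.refl _ _, hq⟩).1

end Octo

/-- Extensions of the elementary abelian group of order eight by a splittable group of odd order
are splittable. -/
theorem IsSplittable.of_octo_quotient {K : Type*} [AddCommGroup K] [Finite K]
    (π : K →+ ZMod 2 × ZMod 2 × ZMod 2) (hπ : Function.Surjective π)
    (hodd : Odd (Nat.card π.ker)) (h : IsSplittable π.ker) : IsSplittable K := by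
  classical
  obtain ⟨θ, G, hθ, hG, hc, u, hne, hall⟩ := h
  let s := Function.surjInv hπ
  have hs : ∀ q, π (s q) = q := Function.surjInv_eq hπ
  let t₂ := s (0, 1, 0)
  let t₃ := s (0, 0, 1)
  let t₄ := s (1, 1, 0)
  have h22 : t₂ + t₂ ∈ π.ker := by
    rw [AddMonoidHom.mem_ker, map_add, hs]; decide
  -- As in the Klein case, `u₀`, `t₁` and `t₅` are each obtained by solving one of the sum
  -- identities for the four points; the remaining identity then holds.
  obtain ⟨u₀, hu₀⟩ := hθ.2 (⟨t₂ + t₂, h22⟩ + θ (θ u) + u)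
  have hu₀' : (u₀ : K) + θ u₀ = t₂ + t₂ + θ (θ u) + u := by
    have := congrArg (Subtype.val) hu₀
    simpa using this
  have hker : ∀ x : π.ker, π x = 0 := fun x => x.2
  let t₁ : K := t₄ + u + θ u₀ - u - t₂ - u
  have ht₁ : π t₁ = (1, 0, 0) := by
    simp only [t₁, t₂, t₄, map_sub, map_add, hs, hker]; decide
  let t₅ : K := t₁ + u + t₃ + θ (θ u) - t₄ - u - u
  have ht₅ : π t₅ = (0, 1, 1) := by
    simp only [t₅, t₃, t₄, map_sub, map_add, hs, ht₁, hker]; decide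
  let t : ZMod 2 × ZMod 2 × ZMod 2 → K := fun q =>
    if q = 0 then 0 else if q = (1, 0, 0) then t₁ else if q = (0, 1, 1) then t₅ else s q
  have ht : ∀ q, π (t q) = q := by
    intro q
    by_cases h0 : q = 0
    · simp [t, h0]
    by_cases h1 : q = (1, 0, 0)
    · simp only [t, h1, if_true]; exact ht₁
    by_cases h5 : q = (0, 1, 1)
    · simp only [t, h5, if_true]; exact ht₅
    simp only [t, h0, h1, h5, if_false, hs]
  let E := levelEquiv π t ht
  have E0 : ∀ x, E (0, x) = x := fun x => by simp [E, levelEquiv_apply, t]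
  have E1 : ∀ x, E ((1, 0, 0), x) = t₁ + x := fun x => rfl
  have E2 : ∀ x, E ((0, 1, 0), x) = t₂ + x := fun x => rfl
  have E3 : ∀ x, E ((0, 0, 1), x) = t₃ + x := fun x => rfl
  have E4 : ∀ x, E ((1, 1, 0), x) = t₄ + x := fun x => rfl
  have E5 : ∀ x, E ((0, 1, 1), x) = t₅ + x := fun x => rfl
  -- The twist `G` sits over `(1, 0, 1)`, a level containing none of the four exchanged points, so
  -- the three of them off the zero level keep their fibre coordinate under `f`.
  let ψ := octoFamily θ G
  let f := levelPerm π t ht octoPerm ψ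
  have hfam : ∀ χ₁ χ₂ : Equiv.Perm π.ker, IsCompleteMapping χ₁ → IsCompleteMapping χ₂ →
      ∀ q, IsCompleteMapping (octoFamily χ₁ χ₂ q) := by
    intro χ₁ χ₂ h1 h2 q
    unfold octoFamily
    split_ifs
    exacts [h1, h2, isCompleteMapping_one hodd]
  have hf : IsCompleteMapping f :=
    isCompleteMapping_levelPerm π t ht isCompleteMapping_octoPerm (hfam _ _ hθ hG)
  let P : Fin 4 → (ZMod 2 × ZMod 2 × ZMod 2) × π.ker :=
    ![(0, u₀), ((1, 0, 0), u), ((0, 1, 0), θ (θ u)), ((1, 1, 0), u)]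
  have hP : ∀ i j, (P i).1 = (P j).1 → i = j := by
    have h1 : ∀ i, (P i).1 = (![0, (1, 0, 0), (0, 1, 0), (1, 1, 0)] : Fin 4 → _) i := by
      intro i; fin_cases i <;> rfl
    intro i j
    rw [h1, h1]
    have : Function.Injective
        (![0, (1, 0, 0), (0, 1, 0), (1, 1, 0)] : Fin 4 → ZMod 2 × ZMod 2 × ZMod 2) := by
      unfold Function.Injective; decide
    exact fun h => this h
  let R : Fin 4 → K := fun i => E (P i)
  have R0 : R 0 = u₀ := E0 _
  have R1 : R 1 = t₁ + u := E1 _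
  have R2 : R 2 = t₂ + θ (θ u) := E2 _
  have R3 : R 3 = t₄ + u := E4 _
  have hR : Function.Injective R := fun i j hij => hP i j (congrArg Prod.fst (E.injective hij))
  have fR : ∀ p, f (E p) = E (shear octoPerm ψ p) := levelPerm_apply π t ht octoPerm ψ
  have fR0 : f (R 0) = E (0, θ u₀) := fR _
  have fR1 : f (R 1) = E ((0, 1, 0), u) := fR _
  have fR2 : f (R 2) = E ((0, 0, 1), θ (θ u)) := fR _
  have fR3 : f (R 3) = E ((0, 1, 1), u) := fR _
  have hsc : ∀ p p', f.SameCycle (E p) (E p') ↔ (shear octoPerm ψ).SameCycle p p' :=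
    fun p p' => sameCycle_levelPerm π t ht
  have n0 : ∀ q, q ≠ 0 → ∀ x, ¬ f.SameCycle (R 0) (E (q, x)) := fun q hq x h =>
    not_shear_octo_zero θ G hq u₀ x ((hsc _ _).1 h)
  have hcov : ∀ x, f.SameCycle (R 0) x ∨ f.SameCycle (R 1) x ∨ f.SameCycle (R 2) x := by
    intro k
    obtain ⟨⟨q, x⟩, rfl⟩ := E.surjective k
    by_cases hq : q = 0
    · left
      subst hq
      exact (hsc _ _).2 (shear_octo_zero θ G (hc _ _))
    · right
      exact (hall x).imp (fun h => (hsc _ _).2 (shear_octo θ G (by decide) hq h))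
        (fun h => (hsc _ _).2 (shear_octo θ G (by decide) hq h))
  have h12 : ¬ f.SameCycle (R 1) (R 2) := fun h =>
    hne (of_shear_octo θ G (by decide) ((hsc _ _).1 h))
  obtain ⟨g, hg, hgc, hg0, hgo⟩ := exists_spliced hf R hR
    (by
      rw [fR3, fR2, R0, R2, E3, E5]
      have : (u₀ : K) + (t₅ + u) = (u₀ + θ u₀) + t₃ + θ (θ u) - t₂ - u := by
        simp only [t₅, t₁]; abel
      rw [this, hu₀']; abel)
    (by
      rw [fR3, fR2, R1, R3, E3, E5]; simp only [t₅]; abel)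
    (by
      rw [fR1, fR0, R0, R2, E0, E2, hu₀']; abel)
    (by
      rw [fR1, fR0, R1, R3, E0, E2]; simp only [t₁]; abel)
    hcov (n0 _ (by decide) _) (n0 _ (by decide) _) h12 (n0 _ (by decide) _)
  let χ := octoFamily θ θ
  let F := levelPerm π t ht octoPerm χ
  have hsF : ∀ p p', F.SameCycle (E p) (E p') ↔ (shear octoPerm χ).SameCycle p p' :=
    fun p p' => sameCycle_levelPerm π t ht
  have hu : θ (θ⁻¹ u₀) = u₀ := perm_apply_inv_self _ _
  have hfix : u₀ ≠ θ⁻¹ u₀ := by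
    intro h
    have hf : θ u₀ = u₀ := by rw [h, hu, ← h]
    have hsub : u = u₀ := mem_of_sameCycle θ {u₀}
      (fun x hx => by rw [Set.mem_singleton_iff.1 hx]; exact hf) (hc u₀ u) rfl
    exact hne (by rw [hsub, hf, hf])
  have g1 : g (E (0, θ⁻¹ u₀)) = R 0 := by
    rw [hgo, fR]
    · change E (0, θ (θ⁻¹ u₀)) = _
      rw [hu]; rfl
    · rintro ⟨i, hi⟩
      have h1 := E.injective hi
      have h2 : i = 0 := hP i 0 (by rw [h1]; rfl)
      subst h2
      exact hfix (congrArg Prod.snd h1)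
  have g2 : g (g (E (0, θ⁻¹ u₀))) = E ((0, 1, 1), u) := by rw [g1, hg0, fR3]
  refine ⟨g, F, hg, ?_, hgc, E (0, θ⁻¹ u₀), ?_, ?_⟩
  · exact isCompleteMapping_levelPerm π t ht isCompleteMapping_octoPerm (hfam _ _ hθ hθ)
  · rw [g2, hsF]
    exact not_shear_octo_zero θ θ (by decide) _ _
  · intro k
    rw [g2]
    obtain ⟨⟨q, x⟩, rfl⟩ := E.surjective k
    rw [hsF, hsF]
    by_cases hq : q = 0
    · left
      subst hq
      exact shear_octo_zero θ θ (hc _ _)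
    · right
      exact shear_octo θ θ (by decide) hq (hc _ _)

/-! ### Small groups from explicit sequences -/

/-- The successor on `Fin (n + 1)` has a single cycle. -/
theorem sameCycle_add_one (n : ℕ) (x y : Fin (n + 1)) :
    (Equiv.addRight (1 : Fin (n + 1))).SameCycle x y :=
  sameCycle_addRight (N := ZMod (n + 1)) 1
    (fun x => AddSubgroup.mem_zmultiples_iff.2 ⟨x.val, by simp⟩) x y

/-- Splittability from two cyclic sequences with distinct consecutive sums, one running through
all elements and one through all nonzero elements. -/
theorem isSplittable_of_sequences {K : Type*} [AddCommGroup K] [Finite K] {n : ℕ}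
    (hK : Nat.card K = n + 2) (c : Fin (n + 2) → K) (d : Fin (n + 1) → K)
    (hc : ∀ i j, c i = c j → i = j) (hcs : ∀ i j, c i + c (i + 1) = c j + c (j + 1) → i = j)
    (hd : ∀ i j, d i = d j → i = j) (hds : ∀ i j, d i + d (i + 1) = d j + d (j + 1) → i = j)
    (hd0 : ∀ i, d i ≠ 0) (hds0 : ∀ i, d i + d (i + 1) ≠ 0) (hc0 : c 0 = 0)
    (hc2 : c (0 + 1 + 1) ≠ 0) : IsSplittable K := by
  have bij : ∀ {ι : Type} [Finite ι] (e : ι → K), Nat.card ι = n + 2 → Function.Injective e →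
      Function.Bijective e := fun e he hi =>
    (Nat.bijective_iff_injective_and_card e).2 ⟨hi, he.trans hK.symm⟩
  let C : Fin (n + 2) ≃ K := Equiv.ofBijective c (bij c (by simp) hc)
  have hD : Function.Injective (fun o : Option (Fin (n + 1)) => o.elim 0 d) := by
    rintro (_ | i) (_ | j) h
    · rfl
    · exact absurd h.symm (hd0 j)
    · exact absurd h (hd0 i)
    · exact congrArg some (hd i j h)
  let D : Option (Fin (n + 1)) ≃ K := Equiv.ofBijective _ (bij _ (by simp) hD)
  let θ := C.permCongr (Equiv.addRight 1)
  -- `G` fixes `0` and rotates the sequence `d`. With `u = 0`, separation only asks that the entry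
  -- of `c` two places after `0` be nonzero.
  let G := D.permCongr (Equiv.optionCongr (Equiv.addRight 1))
  have hθC : ∀ i, θ (C i) = C (i + 1) := fun i => by simp [θ, Equiv.permCongr_apply]
  have hGs : ∀ i, G (D (some i)) = D (some (i + 1)) := fun i => by simp [G, Equiv.permCongr_apply]
  have hG0 : G (D none) = D none := by simp [G, Equiv.permCongr_apply]
  have hD0 : D none = 0 := rfl
  have hDs : ∀ i, D (some i) = d i := fun _ => rfl
  have hCc : ∀ i, C i = c i := fun _ => rfl
  have hfix : ∀ x, G.SameCycle 0 x → x = 0 := fun x h => mem_of_sameCycle G {0} (fun y hy => by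
    rw [Set.mem_singleton_iff.1 hy, ← hD0, hG0]; rfl) h rfl
  have hθ2 : θ (θ 0) = c (0 + 1 + 1) := by
    rw [← hc0, ← hCc, hθC, hθC, hCc]
  refine ⟨θ, G, ?_, ?_, ?_, 0, ?_, ?_⟩
  · apply Finite.injective_iff_bijective.1
    intro x y h
    obtain ⟨i, rfl⟩ := C.surjective x
    obtain ⟨j, rfl⟩ := C.surjective y
    simp only [hθC] at h
    rw [hcs i j h]
  · apply Finite.injective_iff_bijective.1
    intro x y h
    obtain ⟨i, rfl⟩ := D.surjective x
    obtain ⟨j, rfl⟩ := D.surjective y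
    rcases i with _ | i <;> rcases j with _ | j <;> simp only [hD0, hDs] at h ⊢
    · rw [← hD0, hG0, ← hDs, hGs, hDs, hDs, hD0, add_zero] at h
      exact absurd h.symm (hds0 j)
    · rw [← hD0, hG0, ← hDs, hGs, hDs, hDs, hD0, add_zero] at h
      exact absurd h (hds0 i)
    · rw [← hDs, ← hDs, hGs, hGs] at h
      rw [hds i j h]
  · intro x y
    obtain ⟨i, rfl⟩ := C.surjective x
    obtain ⟨j, rfl⟩ := C.surjective y
    exact sameCycle_map C (fun i => (hθC i).symm) (sameCycle_add_one _ i j)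
  · intro h
    rw [hθ2] at h
    exact hc2 (hfix _ h)
  · intro x
    rw [hθ2]
    by_cases hx : x = 0
    · left; rw [hx]
    · right
      obtain ⟨i, hi⟩ := D.surjective x
      obtain ⟨j, hj⟩ := D.surjective (c (0 + 1 + 1))
      rcases i with _ | i
      · exact absurd hi.symm hx
      rcases j with _ | j
      · exact absurd hj.symm hc2
      rw [← hi, ← hj]
      exact sameCycle_map (fun i => D (some i)) (fun i => (hGs i).symm) (sameCycle_add_one _ j i)

theorem isSplittable_zmod_2_4 : IsSplittable (ZMod 2 × ZMod 4) :=
  isSplittable_of_sequences (n := 6) (by simp)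
    (![(0,0), (1,0), (1,1), (1,2), (0,1), (0,3), (1,3), (0,2)])
    (![(0,1), (1,2), (1,0), (1,1), (0,3), (1,3), (0,2)])
    (by decide) (by decide) (by decide) (by decide) (by decide) (by decide) rfl (by decide)

theorem isSplittable_zmod_2_8 : IsSplittable (ZMod 2 × ZMod 8) :=
  isSplittable_of_sequences (n := 14) (by simp)
    (![(0,0), (1,2), (0,1), (1,4), (1,6), (1,1), (1,0), (0,7), (0,4), (1,5), (1,7), (0,5),
      (1,3), (0,3), (0,2), (0,6)])
    (![(0,1), (1,6), (1,1), (1,4), (1,0), (0,4), (0,7), (0,2), (1,7), (1,3), (0,3), (1,2),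
      (0,6), (1,5), (0,5)])
    (by decide) (by decide) (by decide) (by decide) (by decide) (by decide) rfl (by decide)

theorem isSplittable_zmod_4_4 : IsSplittable (ZMod 4 × ZMod 4) :=
  isSplittable_of_sequences (n := 14) (by simp)
    (![(0,0), (0,3), (2,2), (3,3), (3,0), (2,3), (1,2), (1,0), (3,2), (0,2), (3,1), (1,3),
      (0,1), (1,1), (2,1), (2,0)])
    (![(0,1), (0,2), (3,0), (2,3), (3,2), (3,1), (1,0), (1,2), (2,2), (0,3), (2,1), (3,3),
      (1,3), (2,0), (1,1)])
    (by decide) (by decide) (by decide) (by decide) (by decide) (by decide) rfl (by decide)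

theorem isSplittable_zmod_2_2_4 : IsSplittable (ZMod 2 × ZMod 2 × ZMod 4) :=
  isSplittable_of_sequences (n := 14) (by simp)
    (![(0,0,0), (0,1,1), (0,0,3), (0,1,0), (0,1,3), (1,0,2), (0,1,2), (1,1,2), (1,1,0),
      (1,1,1), (0,0,1), (1,0,0), (0,0,2), (1,0,1), (1,0,3), (1,1,3)])
    (![(0,0,1), (0,1,3), (1,1,0), (0,0,3), (1,1,2), (1,1,1), (1,0,2), (1,1,3), (0,1,1),
      (1,0,3), (0,0,2), (0,1,0), (0,1,2), (1,0,0), (1,0,1)])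
    (by decide) (by decide) (by decide) (by decide) (by decide) (by decide) rfl (by decide)

theorem isSplittable_zmod_2_2_3 : IsSplittable (ZMod 2 × ZMod 2 × ZMod 3) :=
  isSplittable_of_sequences (n := 10) (by simp)
    (![(0,0,0), (0,0,2), (1,0,1), (1,0,0), (1,1,0), (0,1,1), (1,1,1), (1,1,2), (0,0,1),
      (0,1,0), (1,0,2), (0,1,2)])
    (![(0,0,1), (1,0,1), (1,1,2), (0,0,2), (1,1,1), (0,1,2), (1,0,0), (1,0,2), (1,1,0),
      (0,1,1), (0,1,0)])
    (by decide) (by decide) (by decide) (by decide) (by decide) (by decide) rfl (by decide)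

theorem isSplittable_zmod_2_2_2_3 : IsSplittable (ZMod 2 × ZMod 2 × ZMod 2 × ZMod 3) :=
  isSplittable_of_sequences (n := 22) (by simp)
    (![(0,0,0,0), (1,0,0,0), (0,1,0,2), (1,0,0,2), (0,1,1,2), (0,1,0,1), (1,0,1,1),
      (1,1,1,1), (0,1,1,0), (1,1,1,2), (1,0,0,1), (1,1,0,0), (0,1,1,1), (0,1,0,0),
      (0,0,1,2), (0,0,1,0), (0,0,1,1), (0,0,0,1), (1,0,1,2), (1,1,0,2), (1,1,0,1),
      (0,0,0,2), (1,0,1,0), (1,1,1,0)])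
    (![(0,0,0,1), (0,1,0,0), (0,0,0,2), (1,0,0,2), (0,1,1,0), (0,1,1,1), (1,1,0,2),
      (1,0,1,1), (0,1,0,2), (1,1,0,0), (1,0,0,0), (0,0,1,2), (1,1,1,1), (1,0,0,1),
      (1,0,1,0), (1,1,0,1), (0,0,1,0), (1,1,1,2), (1,1,1,0), (0,1,0,1), (0,1,1,2),
      (1,0,1,2), (0,0,1,1)])
    (by decide) (by decide) (by decide) (by decide) (by decide) (by decide) rfl (by decide)

/-! ### Strands of a strip -/

section Strands

variable {α : Type*} (r : Setoid α) (p : ℕ → ZMod 2 → α) {k : ℕ}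

/-- Propagation of a relation along the blocks of a strip, the parity of the switch being that of
the position. -/
theorem strip_of_odd (hk : 0 < k)
    (e0 : ∀ o, Even o → 2 ≤ o → o < 4 * k → r (p o 0) (p (o + 1) 0))
    (e1 : ∀ o, Even o → 2 ≤ o → o < 4 * k → r (p o 1) (p (o + 2) 1))
    (o0 : ∀ o, Odd o → 2 ≤ o → o < 4 * k → r (p o 0) (p (o + 2) 1))
    (o1 : ∀ o, Odd o → 2 ≤ o → o < 4 * k → r (p o 1) (p (o + 1) 0)) :
    r (p 2 1) (p (4 * k) 1) ∧ r (p 3 1) (p (4 * k) 0) ∧ r (p 2 0) (p (4 * k + 1) 1) ∧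
    ∀ o b, 2 ≤ o → o < 4 * k → r (p 2 0) (p o b) ∨ r (p 2 1) (p o b) ∨ r (p 3 1) (p o b) := by
  -- Three strands enter at `(2, 0)`, `(2, 1)` and `(3, 1)`; four positions further on they are
  -- found at the corresponding points, in the same order. Hence the exits at `4 * k` do not depend
  -- on `k`.
  have main : ∀ j, j < k → r (p 2 0) (p (4 * j + 2) 0) ∧ r (p 2 1) (p (4 * j + 2) 1) ∧
      r (p 3 1) (p (4 * j + 3) 1) ∧ r (p 2 0) (p (4 * j + 3) 0) ∧ r (p 2 1) (p (4 * j + 4) 1) ∧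
      r (p 3 1) (p (4 * j + 4) 0) ∧ r (p 2 0) (p (4 * j + 5) 1) := by
    have block : ∀ j, j < k → r (p 2 0) (p (4 * j + 2) 0) → r (p 2 1) (p (4 * j + 2) 1) →
        r (p 3 1) (p (4 * j + 3) 1) → r (p 2 0) (p (4 * j + 3) 0) ∧ r (p 2 1) (p (4 * j + 4) 1) ∧
        r (p 3 1) (p (4 * j + 4) 0) ∧ r (p 2 0) (p (4 * j + 5) 1) := by
      intro j hj h0 h1 h2
      have a1 := r.trans h0 (e0 (4 * j + 2) ⟨2 * j + 1, by ring⟩ (by omega) (by omega))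
      exact ⟨a1, r.trans h1 (e1 (4 * j + 2) ⟨2 * j + 1, by ring⟩ (by omega) (by omega)),
        r.trans h2 (o1 (4 * j + 3) ⟨2 * j + 1, by ring⟩ (by omega) (by omega)),
        r.trans a1 (o0 (4 * j + 3) ⟨2 * j + 1, by ring⟩ (by omega) (by omega))⟩
    intro j
    induction j with
    | zero => exact fun h => ⟨r.refl _, r.refl _, r.refl _, block 0 h (r.refl _) (r.refl _) (r.refl _)⟩
    | succ j ih =>
      intro h
      obtain ⟨-, -, -, -, h4, h5, h6⟩ := ih (by omega)
      have a1 : r (p 2 0) (p (4 * (j + 1) + 2) 0) :=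
        r.trans h6 (o1 (4 * j + 5) ⟨2 * j + 2, by ring⟩ (by omega) (by omega))
      have a2 : r (p 2 1) (p (4 * (j + 1) + 2) 1) :=
        r.trans h4 (e1 (4 * j + 4) ⟨2 * j + 2, by ring⟩ (by omega) (by omega))
      have a3 : r (p 3 1) (p (4 * (j + 1) + 3) 1) :=
        r.trans (r.trans h5 (e0 (4 * j + 4) ⟨2 * j + 2, by ring⟩ (by omega) (by omega)))
          (o0 (4 * j + 5) ⟨2 * j + 2, by ring⟩ (by omega) (by omega))
      exact ⟨a1, a2, a3, block (j + 1) h a1 a2 a3⟩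
  obtain ⟨-, -, -, -, h4, h5, h6⟩ := main (k - 1) (by omega)
  have hk4 : 4 * (k - 1) + 4 = 4 * k := by omega
  have hk5 : 4 * (k - 1) + 5 = 4 * k + 1 := by omega
  rw [hk4] at h4 h5
  rw [hk5] at h6
  refine ⟨h4, h5, h6, ?_⟩
  intro o b ho2 ho
  have hb : b = 0 ∨ b = 1 := by revert b; decide
  obtain ⟨j, hj, hm⟩ : ∃ j < k, o = 4 * j + 2 ∨ o = 4 * j + 3 ∨ o = 4 * j + 4 ∨ o = 4 * j + 5 :=
    ⟨(o - 2) / 4, by omega, by omega⟩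
  obtain ⟨h0, h1, h2, h3, h4, h5, h6⟩ := main j hj
  rcases hm with rfl | rfl | rfl | rfl <;> rcases hb with rfl | rfl
  · exact Or.inl h0
  · exact Or.inr (Or.inl h1)
  · exact Or.inl h3
  · exact Or.inr (Or.inr h2)
  · exact Or.inr (Or.inr h5)
  · exact Or.inr (Or.inl h4)
  · exact Or.inr (Or.inr (r.trans h5 (e0 (4 * j + 4) ⟨2 * j + 2, by ring⟩ (by omega) (by omega))))
  · exact Or.inl h6

/-- Propagation of a relation along the blocks of a strip, the parity of the switch being opposite
to that of the position. -/
theorem strip_of_even (hk : 0 < k)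
    (e0 : ∀ o, Even o → 2 ≤ o → o < 4 * k → r (p o 0) (p (o + 2) 1))
    (e1 : ∀ o, Even o → 2 ≤ o → o < 4 * k → r (p o 1) (p (o + 1) 0))
    (o0 : ∀ o, Odd o → 2 ≤ o → o < 4 * k → r (p o 0) (p (o + 1) 0))
    (o1 : ∀ o, Odd o → 2 ≤ o → o < 4 * k → r (p o 1) (p (o + 2) 1)) :
    r (p 2 0) (p (4 * k) 1) ∧ r (p 2 1) (p (4 * k) 0) ∧ r (p 3 1) (p (4 * k + 1) 1) ∧
    ∀ o b, 2 ≤ o → o < 4 * k → r (p 2 0) (p o b) ∨ r (p 2 1) (p o b) ∨ r (p 3 1) (p o b) := by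
  have main : ∀ j, j < k → r (p 2 0) (p (4 * j + 2) 0) ∧ r (p 2 1) (p (4 * j + 2) 1) ∧
      r (p 3 1) (p (4 * j + 3) 1) ∧ r (p 2 1) (p (4 * j + 3) 0) ∧ r (p 2 1) (p (4 * j + 4) 0) ∧
      r (p 2 0) (p (4 * j + 4) 1) ∧ r (p 3 1) (p (4 * j + 5) 1) := by
    have block : ∀ j, j < k → r (p 2 0) (p (4 * j + 2) 0) → r (p 2 1) (p (4 * j + 2) 1) →
        r (p 3 1) (p (4 * j + 3) 1) → r (p 2 1) (p (4 * j + 3) 0) ∧ r (p 2 1) (p (4 * j + 4) 0) ∧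
        r (p 2 0) (p (4 * j + 4) 1) ∧ r (p 3 1) (p (4 * j + 5) 1) := by
      intro j hj h0 h1 h2
      have a1 := r.trans h1 (e1 (4 * j + 2) ⟨2 * j + 1, by ring⟩ (by omega) (by omega))
      exact ⟨a1, r.trans a1 (o0 (4 * j + 3) ⟨2 * j + 1, by ring⟩ (by omega) (by omega)),
        r.trans h0 (e0 (4 * j + 2) ⟨2 * j + 1, by ring⟩ (by omega) (by omega)),
        r.trans h2 (o1 (4 * j + 3) ⟨2 * j + 1, by ring⟩ (by omega) (by omega))⟩
    intro j
    induction j with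
    | zero => exact fun h => ⟨r.refl _, r.refl _, r.refl _, block 0 h (r.refl _) (r.refl _) (r.refl _)⟩
    | succ j ih =>
      intro h
      obtain ⟨-, -, -, -, h4, h5, h6⟩ := ih (by omega)
      have a1 : r (p 2 0) (p (4 * (j + 1) + 2) 0) :=
        r.trans (r.trans h5 (e1 (4 * j + 4) ⟨2 * j + 2, by ring⟩ (by omega) (by omega)))
          (o0 (4 * j + 5) ⟨2 * j + 2, by ring⟩ (by omega) (by omega))
      have a2 : r (p 2 1) (p (4 * (j + 1) + 2) 1) :=
        r.trans h4 (e0 (4 * j + 4) ⟨2 * j + 2, by ring⟩ (by omega) (by omega))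
      have a3 : r (p 3 1) (p (4 * (j + 1) + 3) 1) :=
        r.trans h6 (o1 (4 * j + 5) ⟨2 * j + 2, by ring⟩ (by omega) (by omega))
      exact ⟨a1, a2, a3, block (j + 1) h a1 a2 a3⟩
  obtain ⟨-, -, -, -, h4, h5, h6⟩ := main (k - 1) (by omega)
  have hk4 : 4 * (k - 1) + 4 = 4 * k := by omega
  have hk5 : 4 * (k - 1) + 5 = 4 * k + 1 := by omega
  rw [hk4] at h4 h5
  rw [hk5] at h6
  refine ⟨h5, h4, h6, ?_⟩
  intro o b ho2 ho
  have hb : b = 0 ∨ b = 1 := by revert b; decide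
  obtain ⟨j, hj, hm⟩ : ∃ j < k, o = 4 * j + 2 ∨ o = 4 * j + 3 ∨ o = 4 * j + 4 ∨ o = 4 * j + 5 :=
    ⟨(o - 2) / 4, by omega, by omega⟩
  obtain ⟨h0, h1, h2, h3, h4, h5, h6⟩ := main j hj
  rcases hm with rfl | rfl | rfl | rfl <;> rcases hb with rfl | rfl
  · exact Or.inl h0
  · exact Or.inr (Or.inl h1)
  · exact Or.inr (Or.inl h3)
  · exact Or.inr (Or.inr h2)
  · exact Or.inr (Or.inl h4)
  · exact Or.inl h5
  · exact Or.inl (r.trans h5 (e1 (4 * j + 4) ⟨2 * j + 2, by ring⟩ (by omega) (by omega)))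
  · exact Or.inr (Or.inr h6)

end Strands

/-! ### A complete mapping of `Z_{16k} ⊕ Z_2` by short and long steps -/

section Family

/-- The positions at which the upper level makes a short step. -/
def IsSwitched (L n : ℕ) : Prop :=
  (n < L ∧ n ≠ 1 ∧ n % 2 = 1) ∨ (L ≤ n ∧ n < 2 * L ∧ n % 2 = 0) ∨
    (2 * L ≤ n ∧ n < 3 * L ∧ (n % 2 = 0 ∨ n = 2 * L + 1)) ∨ (3 * L ≤ n ∧ n % 2 = 1)

instance (L n : ℕ) : Decidable (IsSwitched L n) := by unfold IsSwitched; infer_instance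

/-- The level making a short step at position `n`. -/
def switchBit (L n : ℕ) : ZMod 2 := if IsSwitched L n then 1 else 0

theorem switchBit_eq_iff {L n m : ℕ} :
    switchBit L n = switchBit L m ↔ (IsSwitched L n ↔ IsSwitched L m) := by
  unfold switchBit
  split_ifs <;> simp [*]

/-- Short steps lead to the lower level and long steps to the upper level. -/
def stepFun (k : ℕ) (x : ZMod (16 * k) × ZMod 2) : ZMod (16 * k) × ZMod 2 :=
  if x.2 = switchBit (4 * k) x.1.val then (x.1 + 1, 0) else (x.1 + 2, 1)

theorem stepFun_injective (k : ℕ) : Function.Injective (stepFun k) := by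
  rintro ⟨i, b⟩ ⟨j, c⟩ h
  have two : ∀ x y z : ZMod 2, x ≠ z → y ≠ z → x = y := by decide
  unfold stepFun at h
  have h01 : (0 : ZMod 2) ≠ 1 := by decide
  split_ifs at h with h1 h2 h2
  · have hij : i = j := add_right_cancel (b := 1) (congrArg Prod.fst h)
    subst hij
    exact Prod.ext rfl (h1.trans h2.symm)
  · exact absurd (congrArg Prod.snd h) h01
  · exact absurd (congrArg Prod.snd h).symm h01
  · have hij : i = j := add_right_cancel (b := 2) (congrArg Prod.fst h)
    subst hij
    exact Prod.ext rfl (two _ _ _ h1 h2)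

/-- The element over position `n` at level `b`. -/
def pos (k n : ℕ) (b : ZMod 2) : ZMod (16 * k) × ZMod 2 := (n, b)

theorem pos_injOn {k n n' : ℕ} {b b' : ZMod 2} (hn : n < 16 * k) (hn' : n' < 16 * k)
    (h : pos k n b = pos k n' b') : n = n' ∧ b = b' := by
  refine ⟨?_, congrArg Prod.snd h⟩
  have := congrArg (fun x => x.1.val) h
  simpa [pos, ZMod.val_natCast_of_lt hn, ZMod.val_natCast_of_lt hn'] using this

variable (k : ℕ) [NeZero k]

/-- The permutation of `ZMod (16 * k) × ZMod 2` making short and long steps. -/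
noncomputable def stepPerm : Equiv.Perm (ZMod (16 * k) × ZMod 2) :=
  Equiv.ofBijective _ (Finite.injective_iff_bijective.1 (stepFun_injective k))

variable {k}

theorem stepPerm_pos {n : ℕ} (hn : n < 16 * k) (b : ZMod 2) :
    stepPerm k (pos k n b) =
      if b = switchBit (4 * k) n then pos k (n + 1) 0 else pos k (n + 2) 1 := by
  change stepFun k _ = _
  unfold stepFun pos
  rw [ZMod.val_natCast_of_lt hn]
  push_cast
  rfl

theorem stepPerm_zero_short {n : ℕ} (hn : n < 16 * k) (h : ¬ IsSwitched (4 * k) n) :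
    stepPerm k (pos k n 0) = pos k (n + 1) 0 := by
  simp [stepPerm_pos hn, switchBit, h]

theorem stepPerm_one_short {n : ℕ} (hn : n < 16 * k) (h : IsSwitched (4 * k) n) :
    stepPerm k (pos k n 1) = pos k (n + 1) 0 := by
  simp [stepPerm_pos hn, switchBit, h]

theorem stepPerm_zero_long {n : ℕ} (hn : n < 16 * k) (h : IsSwitched (4 * k) n) :
    stepPerm k (pos k n 0) = pos k (n + 2) 1 := by
  simp [stepPerm_pos hn, switchBit, h]

theorem stepPerm_one_long {n : ℕ} (hn : n < 16 * k) (h : ¬ IsSwitched (4 * k) n) :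
    stepPerm k (pos k n 1) = pos k (n + 2) 1 := by
  simp [stepPerm_pos hn, switchBit, h]

theorem exists_pos (x : ZMod (16 * k) × ZMod 2) : ∃ n < 16 * k, ∃ b, pos k n b = x :=
  ⟨x.1.val, ZMod.val_lt _, x.2, by simp [pos]⟩

/-- A short step at `n` has sum `(2n + 1, s)` and a long one `(2n + 2, s)`, with `s` the switch bit
of `n`. The parity of the first coordinate tells short from long, the coordinate itself gives `n`
modulo `8k`, and `s` separates `n` from `n + 8k`. -/
theorem isCompleteMapping_stepPerm : IsCompleteMapping (stepPerm k) := by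
  have hk : 0 < k := Nat.pos_of_ne_zero (NeZero.ne k)
  apply Finite.injective_iff_bijective.1
  intro x y h
  obtain ⟨n, hn, b, rfl⟩ := exists_pos x
  obtain ⟨m, hm, c, rfl⟩ := exists_pos y
  have key : ∀ n b, n < 16 * k → ∃ e : ℕ, pos k n b + stepPerm k (pos k n b) =
      pos k (2 * n + e) (switchBit (4 * k) n) ∧
      ((e = 1 ∧ b = switchBit (4 * k) n) ∨
        (e = 2 ∧ b ≠ switchBit (4 * k) n)) := by
    intro n b hn
    have two : ∀ x z : ZMod 2, x ≠ z → x + 1 = z := by decide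
    rw [stepPerm_pos hn]
    split_ifs with h2
    · exact ⟨1, by subst h2; simp [pos]; ring, Or.inl ⟨rfl, h2⟩⟩
    · exact ⟨2, by simp [pos, two _ _ h2]; ring, Or.inr ⟨rfl, h2⟩⟩
  obtain ⟨e, he, hb⟩ := key n b hn
  obtain ⟨e', he', hc⟩ := key m c hm
  have h' : pos k (2 * n + e) (switchBit (4 * k) n) =
      pos k (2 * m + e') (switchBit (4 * k) m) := by rw [← he, ← he']; exact h
  have h1 : (2 * n + e) % (16 * k) = (2 * m + e') % (16 * k) :=
    (ZMod.natCast_eq_natCast_iff' _ _ _).1 (congrArg Prod.fst h')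
  have h2 : IsSwitched (4 * k) n ↔ IsSwitched (4 * k) m :=
    switchBit_eq_iff.1 (congrArg Prod.snd h')
  have hee : e = e' := by
    have h3 : (2 * n + e) % 2 = (2 * m + e') % 2 := by
      rw [← Nat.mod_mod_of_dvd (2 * n + e) (⟨8 * k, by ring⟩ : 2 ∣ 16 * k), h1,
        Nat.mod_mod_of_dvd _ (⟨8 * k, by ring⟩ : 2 ∣ 16 * k)]
    omega
  subst hee
  have hnm : n = m ∨ n + 8 * k = m ∨ m + 8 * k = n := by
    have h3 : 2 * n + e ≡ 2 * m + e [MOD 16 * k] := h1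
    have h4 := Nat.ModEq.add_right_cancel' e h3
    have h5 : n ≡ m [MOD 8 * k] := by
      apply Nat.ModEq.mul_left_cancel' (c := 2) (by norm_num)
      rwa [show 2 * (8 * k) = 16 * k by ring]
    have h6 : n % (8 * k) = m % (8 * k) := h5
    have h7 := Nat.div_add_mod n (8 * k)
    have h8 := Nat.div_add_mod m (8 * k)
    have h9 : n / (8 * k) < 2 := Nat.div_lt_of_lt_mul (by omega)
    have h10 : m / (8 * k) < 2 := Nat.div_lt_of_lt_mul (by omega)
    interval_cases n / (8 * k) <;> interval_cases m / (8 * k) <;> omega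
  -- A shift by half the period takes each quarter to one with the complementary pattern; the
  -- exceptional positions `1` and `8k + 1` correspond to each other.
  have hs : ∀ n, n < 8 * k → (IsSwitched (4 * k) (n + 8 * k) ↔ ¬ IsSwitched (4 * k) n) := by
    intro n hn
    unfold IsSwitched
    omega
  have hnm' : n = m := by
    rcases hnm with h | h | h
    · exact h
    · subst h
      exact absurd ((hs n (by omega)).symm.trans h2.symm) (by tauto)
    · subst h
      exact absurd ((hs m (by omega)).symm.trans h2) (by tauto)
  subst hnm'
  rcases hb with ⟨h3, hb⟩ | ⟨h3, hb⟩ <;> rcases hc with ⟨h4, hc⟩ | ⟨h4, hc⟩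
  · rw [hb, hc]
  · omega
  · omega
  · have two : ∀ x y z : ZMod 2, x ≠ z → y ≠ z → x = y := by decide
    rw [two _ _ _ hb hc]

end Family

/-! ### Reduction to sixteen nodes -/

section Node

theorem pos_strip_injective {k q q' o o' : ℕ} {b b' : ZMod 2} (hq : q < 4) (hq' : q' < 4)
    (ho : o < 4 * k) (ho' : o' < 4 * k)
    (h : pos k (q * (4 * k) + o) b = pos k (q' * (4 * k) + o') b') : q = q' ∧ o = o' ∧ b = b' := by
  have hb : ∀ q o, q < 4 → o < 4 * k → q * (4 * k) + o < 16 * k := by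
    intro q o hq ho
    interval_cases q <;> omega
  obtain ⟨h1, h2⟩ := pos_injOn (hb q o hq ho) (hb q' o' hq' ho') h
  refine ⟨?_, ?_, h2⟩ <;> interval_cases q <;> interval_cases q' <;> omega

/-- The first two positions of each quarter, at both levels. -/
def node (k : ℕ) (i : Fin 16) : ZMod (16 * k) × ZMod 2 :=
  pos k (i.val / 4 * (4 * k) + i.val / 2 % 2) (i.val % 2 : ℕ)

theorem node_eq {k : ℕ} (i : Fin 16) {n : ℕ} {b : ZMod 2} (hn : n = i.val / 4 * (4 * k) + i.val / 2 % 2)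
    (hb : b = (i.val % 2 : ℕ)) : node k i = pos k n b := by
  rw [hn, hb]; rfl

theorem not_mem_range_node {k q o : ℕ} (hq : q < 4) (h2 : 2 ≤ o) (ho : o < 4 * k) (b : ZMod 2) :
    pos k (q * (4 * k) + o) b ∉ Set.range (node k) := by
  rintro ⟨i, hi⟩
  obtain ⟨-, h3, -⟩ := pos_strip_injective (by omega) hq (by omega) ho hi
  omega

theorem node_values {k : ℕ} :
    node k 0 = pos k 0 0 ∧
    node k 1 = pos k 0 1 ∧
    node k 2 = pos k 1 0 ∧
    node k 3 = pos k 1 1 ∧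
    node k 4 = pos k (4 * k) 0 ∧
    node k 5 = pos k (4 * k) 1 ∧
    node k 6 = pos k (4 * k + 1) 0 ∧
    node k 7 = pos k (4 * k + 1) 1 ∧
    node k 8 = pos k (8 * k) 0 ∧
    node k 9 = pos k (8 * k) 1 ∧
    node k 10 = pos k (8 * k + 1) 0 ∧
    node k 11 = pos k (8 * k + 1) 1 ∧
    node k 12 = pos k (12 * k) 0 ∧
    node k 13 = pos k (12 * k) 1 ∧
    node k 14 = pos k (12 * k + 1) 0 ∧
    node k 15 = pos k (12 * k + 1) 1 := by
  refine ⟨?_, ?_, ?_, ?_, ?_, ?_, ?_, ?_, ?_, ?_, ?_, ?_, ?_, ?_, ?_, ?_⟩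
  · exact node_eq 0 (by change _ = 0 * (4 * k) + 0; omega) rfl
  · exact node_eq 1 (by change _ = 0 * (4 * k) + 0; omega) rfl
  · exact node_eq 2 (by change _ = 0 * (4 * k) + 1; omega) rfl
  · exact node_eq 3 (by change _ = 0 * (4 * k) + 1; omega) rfl
  · exact node_eq 4 (by change _ = 1 * (4 * k) + 0; omega) rfl
  · exact node_eq 5 (by change _ = 1 * (4 * k) + 0; omega) rfl
  · exact node_eq 6 (by change _ = 1 * (4 * k) + 1; omega) rfl
  · exact node_eq 7 (by change _ = 1 * (4 * k) + 1; omega) rfl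
  · exact node_eq 8 (by change _ = 2 * (4 * k) + 0; omega) rfl
  · exact node_eq 9 (by change _ = 2 * (4 * k) + 0; omega) rfl
  · exact node_eq 10 (by change _ = 2 * (4 * k) + 1; omega) rfl
  · exact node_eq 11 (by change _ = 2 * (4 * k) + 1; omega) rfl
  · exact node_eq 12 (by change _ = 3 * (4 * k) + 0; omega) rfl
  · exact node_eq 13 (by change _ = 3 * (4 * k) + 0; omega) rfl
  · exact node_eq 14 (by change _ = 3 * (4 * k) + 1; omega) rfl
  · exact node_eq 15 (by change _ = 3 * (4 * k) + 1; omega) rfl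

variable {k : ℕ} [NeZero k]

theorem node_injective : Function.Injective (node k) := by
  intro i j h
  have hk : 0 < k := Nat.pos_of_ne_zero (NeZero.ne k)
  obtain ⟨h1, h2, h3⟩ := pos_strip_injective (by omega) (by omega) (by omega) (by omega) h
  have h4 := (ZMod.natCast_eq_natCast_iff' _ _ _).1 h3
  ext
  omega

theorem exists_strip (x : ZMod (16 * k) × ZMod 2) :
    ∃ q < 4, ∃ o < 4 * k, ∃ b, pos k (q * (4 * k) + o) b = x := by
  obtain ⟨n, hn, b, rfl⟩ := exists_pos x
  have hk : 0 < k := Nat.pos_of_ne_zero (NeZero.ne k)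
  refine ⟨n / (4 * k), Nat.div_lt_of_lt_mul (by omega), n % (4 * k), Nat.mod_lt _ (by omega), b, ?_⟩
  rw [Nat.div_add_mod']

/-- The node at which the strand leaving a node ends. -/
def nextNode : Fin 16 → Fin 16 := ![2, 5, 7, 4, 8, 6, 9, 11, 12, 10, 15, 13, 14, 1, 0, 3]

variable (r : Setoid (ZMod (16 * k) × ZMod 2))
  (h : ∀ q < 4, ∀ o, 2 ≤ o → o < 4 * k → ∀ b,
    r (pos k (q * (4 * k) + o) b) (stepPerm k (pos k (q * (4 * k) + o) b)))

include h

theorem strip_rel_of_odd {q : ℕ} (hq : q = 0 ∨ q = 3) :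
    r (pos k (q * (4 * k) + 2) 1) (pos k (q * (4 * k) + 4 * k) 1) ∧
    r (pos k (q * (4 * k) + 3) 1) (pos k (q * (4 * k) + 4 * k) 0) ∧
    r (pos k (q * (4 * k) + 2) 0) (pos k (q * (4 * k) + (4 * k + 1)) 1) ∧
    ∀ o b, 2 ≤ o → o < 4 * k → r (pos k (q * (4 * k) + 2) 0) (pos k (q * (4 * k) + o) b) ∨
      r (pos k (q * (4 * k) + 2) 1) (pos k (q * (4 * k) + o) b) ∨
      r (pos k (q * (4 * k) + 3) 1) (pos k (q * (4 * k) + o) b) := by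
  have hk : 0 < k := Nat.pos_of_ne_zero (NeZero.ne k)
  have hq4 : q < 4 := by omega
  have hlt : ∀ o, o < 4 * k → q * (4 * k) + o < 16 * k := by
    intro o ho
    rcases hq with rfl | rfl <;> omega
  have he : ∀ o, Even o → 2 ≤ o → o < 4 * k → ¬ IsSwitched (4 * k) (q * (4 * k) + o) := by
    rintro o ⟨c, hc⟩ h2 ho
    unfold IsSwitched
    rcases hq with rfl | rfl <;> omega
  have ho : ∀ o, Odd o → 2 ≤ o → o < 4 * k → IsSwitched (4 * k) (q * (4 * k) + o) := by
    rintro o ⟨c, hc⟩ h2 ho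
    unfold IsSwitched
    rcases hq with rfl | rfl <;> omega
  refine strip_of_odd r (fun o b => pos k (q * (4 * k) + o) b) hk ?_ ?_ ?_ ?_ <;>
    intro o hp h2 hlto
  · have := h q hq4 o h2 hlto 0
    rwa [stepPerm_zero_short (hlt o hlto) (he o hp h2 hlto)] at this
  · have := h q hq4 o h2 hlto 1
    rwa [stepPerm_one_long (hlt o hlto) (he o hp h2 hlto)] at this
  · have := h q hq4 o h2 hlto 0
    rwa [stepPerm_zero_long (hlt o hlto) (ho o hp h2 hlto)] at this
  · have := h q hq4 o h2 hlto 1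
    rwa [stepPerm_one_short (hlt o hlto) (ho o hp h2 hlto)] at this

theorem strip_rel_of_even {q : ℕ} (hq : q = 1 ∨ q = 2) :
    r (pos k (q * (4 * k) + 2) 0) (pos k (q * (4 * k) + 4 * k) 1) ∧
    r (pos k (q * (4 * k) + 2) 1) (pos k (q * (4 * k) + 4 * k) 0) ∧
    r (pos k (q * (4 * k) + 3) 1) (pos k (q * (4 * k) + (4 * k + 1)) 1) ∧
    ∀ o b, 2 ≤ o → o < 4 * k → r (pos k (q * (4 * k) + 2) 0) (pos k (q * (4 * k) + o) b) ∨
      r (pos k (q * (4 * k) + 2) 1) (pos k (q * (4 * k) + o) b) ∨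
      r (pos k (q * (4 * k) + 3) 1) (pos k (q * (4 * k) + o) b) := by
  have hk : 0 < k := Nat.pos_of_ne_zero (NeZero.ne k)
  have hq4 : q < 4 := by omega
  have hlt : ∀ o, o < 4 * k → q * (4 * k) + o < 16 * k := by
    intro o ho
    rcases hq with rfl | rfl <;> omega
  have he : ∀ o, Even o → 2 ≤ o → o < 4 * k → IsSwitched (4 * k) (q * (4 * k) + o) := by
    rintro o ⟨c, hc⟩ h2 ho
    unfold IsSwitched
    rcases hq with rfl | rfl <;> omega
  have ho : ∀ o, Odd o → 2 ≤ o → o < 4 * k → ¬ IsSwitched (4 * k) (q * (4 * k) + o) := by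
    rintro o ⟨c, hc⟩ h2 ho
    unfold IsSwitched
    rcases hq with rfl | rfl <;> omega
  refine strip_of_even r (fun o b => pos k (q * (4 * k) + o) b) hk ?_ ?_ ?_ ?_ <;>
    intro o hp h2 hlto
  · have := h q hq4 o h2 hlto 0
    rwa [stepPerm_zero_long (hlt o hlto) (he o hp h2 hlto)] at this
  · have := h q hq4 o h2 hlto 1
    rwa [stepPerm_one_short (hlt o hlto) (he o hp h2 hlto)] at this
  · have := h q hq4 o h2 hlto 0
    rwa [stepPerm_zero_short (hlt o hlto) (ho o hp h2 hlto)] at this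
  · have := h q hq4 o h2 hlto 1
    rwa [stepPerm_one_long (hlt o hlto) (ho o hp h2 hlto)] at this

/-- The ends of the strands. -/
theorem strip_ends :
    (r (pos k 2 1) (node k 5) ∧ r (pos k 3 1) (node k 4) ∧ r (pos k 2 0) (node k 7)) ∧
    (r (pos k (4 * k + 2) 0) (node k 9) ∧ r (pos k (4 * k + 2) 1) (node k 8) ∧
      r (pos k (4 * k + 3) 1) (node k 11)) ∧
    (r (pos k (8 * k + 2) 0) (node k 13) ∧ r (pos k (8 * k + 2) 1) (node k 12) ∧
      r (pos k (8 * k + 3) 1) (node k 15)) ∧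
    (r (pos k (12 * k + 2) 1) (node k 1) ∧ r (pos k (12 * k + 3) 1) (node k 0) ∧
      r (pos k (12 * k + 2) 0) (node k 3)) := by
  obtain ⟨a1, a2, a3, -⟩ := strip_rel_of_odd r h (q := 0) (by norm_num)
  obtain ⟨b1, b2, b3, -⟩ := strip_rel_of_even r h (q := 1) (by norm_num)
  obtain ⟨c1, c2, c3, -⟩ := strip_rel_of_even r h (q := 2) (by norm_num)
  obtain ⟨d1, d2, d3, -⟩ := strip_rel_of_odd r h (q := 3) (by norm_num)
  have hz : ((16 * k : ℕ) : ZMod (16 * k)) = 0 := ZMod.natCast_self _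
  -- Strands of the last quarter wrap around to the first nodes.
  have w : ∀ o b, pos k (16 * k + o) b = pos k o b := by
    intro o b
    unfold pos
    rw [Nat.cast_add, hz, zero_add]
  have e2 : ∀ o, 2 * (4 * k) + o = 8 * k + o := by intro o; ring
  have e3 : ∀ o, 3 * (4 * k) + o = 12 * k + o := by intro o; ring
  have e4 : 3 * (4 * k) + (4 * k) = 16 * k + 0 := by ring
  have e5 : 3 * (4 * k) + (4 * k + 1) = 16 * k + 1 := by ring
  have e6 : 1 * (4 * k) + (4 * k) = 8 * k := by ring
  have e7 : 1 * (4 * k) + (4 * k + 1) = 8 * k + 1 := by ring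
  have e8 : 2 * (4 * k) + (4 * k) = 12 * k := by ring
  have e9 : 2 * (4 * k) + (4 * k + 1) = 12 * k + 1 := by ring
  rw [e6] at b1 b2
  rw [e7] at b3
  rw [e8] at c1 c2
  rw [e9] at c3
  rw [e4, w] at d1 d2
  rw [e5, w] at d3
  simp only [zero_mul, zero_add, one_mul, e2, e3] at a1 a2 a3 b1 b2 b3 c1 c2 c3 d1 d2 d3
  obtain ⟨n0, n1, -, n3, n4, n5, -, n7, n8, n9, -, n11, n12, n13, -, n15⟩ := node_values (k := k)
  rw [n0, n1, n3, n4, n5, n7, n8, n9, n11, n12, n13, n15]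
  exact ⟨⟨a1, a2, a3⟩, ⟨b1, b2, b3⟩, ⟨c1, c2, c3⟩, d1, d2, d3⟩

/-- Since `r` need only respect steps that start off the nodes, this applies to the cycles of
`stepPerm` and equally to those of any permutation differing from it at nodes alone. -/
theorem rel_nextNode (i : Fin 16) : r (stepPerm k (node k i)) (node k (nextNode i)) := by
  have hk : 0 < k := Nat.pos_of_ne_zero (NeZero.ne k)
  obtain ⟨⟨a1, a2, a3⟩, ⟨b1, b2, b3⟩, ⟨c1, c2, c3⟩, d1, d2, d3⟩ := strip_ends r h
  obtain ⟨n0, n1, n2, n3, n4, n5, n6, n7, n8, n9, n10, n11, n12, n13, n14, n15⟩ :=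
    node_values (k := k)
  fin_cases i
  · change r (stepPerm k (node k 0)) (node k 2)
    rw [n0, stepPerm_zero_short (by omega) (by unfold IsSwitched; omega)]
    rw [n2]
  · change r (stepPerm k (node k 1)) (node k 5)
    rw [n1, stepPerm_one_long (by omega) (by unfold IsSwitched; omega)]
    exact a1
  · change r (stepPerm k (node k 2)) (node k 7)
    rw [n2, stepPerm_zero_short (by omega) (by unfold IsSwitched; omega)]
    exact a3
  · change r (stepPerm k (node k 3)) (node k 4)
    rw [n3, stepPerm_one_long (by omega) (by unfold IsSwitched; omega)]
    exact a2
  · change r (stepPerm k (node k 4)) (node k 8)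
    rw [n4, stepPerm_zero_long (by omega) (by unfold IsSwitched; omega)]
    exact b2
  · change r (stepPerm k (node k 5)) (node k 6)
    rw [n5, stepPerm_one_short (by omega) (by unfold IsSwitched; omega)]
    rw [n6]
  · change r (stepPerm k (node k 6)) (node k 9)
    rw [n6, stepPerm_zero_short (by omega) (by unfold IsSwitched; omega)]
    exact b1
  · change r (stepPerm k (node k 7)) (node k 11)
    rw [n7, stepPerm_one_long (by omega) (by unfold IsSwitched; omega)]
    exact b3
  · change r (stepPerm k (node k 8)) (node k 12)
    rw [n8, stepPerm_zero_long (by omega) (by unfold IsSwitched; omega)]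
    exact c2
  · change r (stepPerm k (node k 9)) (node k 10)
    rw [n9, stepPerm_one_short (by omega) (by unfold IsSwitched; omega)]
    rw [n10]
  · change r (stepPerm k (node k 10)) (node k 15)
    rw [n10, stepPerm_zero_long (by omega) (by unfold IsSwitched; omega)]
    exact c3
  · change r (stepPerm k (node k 11)) (node k 13)
    rw [n11, stepPerm_one_short (by omega) (by unfold IsSwitched; omega)]
    exact c1
  · change r (stepPerm k (node k 12)) (node k 14)
    rw [n12, stepPerm_zero_short (by omega) (by unfold IsSwitched; omega)]
    rw [n14]
  · change r (stepPerm k (node k 13)) (node k 1)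
    rw [n13, stepPerm_one_long (by omega) (by unfold IsSwitched; omega)]
    exact d1
  · change r (stepPerm k (node k 14)) (node k 0)
    rw [n14, stepPerm_zero_long (by omega) (by unfold IsSwitched; omega)]
    exact d2
  · change r (stepPerm k (node k 15)) (node k 3)
    rw [n15, stepPerm_one_short (by omega) (by unfold IsSwitched; omega)]
    exact d3

theorem exists_rel_node (x : ZMod (16 * k) × ZMod 2) : ∃ i, r (node k i) x := by
  have hk : 0 < k := Nat.pos_of_ne_zero (NeZero.ne k)
  obtain ⟨⟨a1, a2, a3⟩, ⟨b1, b2, b3⟩, ⟨c1, c2, c3⟩, d1, d2, d3⟩ := strip_ends r h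
  have e1 : ∀ o, 1 * (4 * k) + o = 4 * k + o := by intro o; ring
  have e2 : ∀ o, 2 * (4 * k) + o = 8 * k + o := by intro o; ring
  have e3 : ∀ o, 3 * (4 * k) + o = 12 * k + o := by intro o; ring
  have comb : ∀ {y z : ZMod (16 * k) × ZMod 2} {i : Fin 16}, r y (node k i) → r y z →
      ∃ i, r (node k i) z := fun h1 h2 => ⟨_, r.trans (r.symm h1) h2⟩
  obtain ⟨q, hq, o, ho, b, rfl⟩ := exists_strip x
  by_cases h2 : 2 ≤ o
  · interval_cases q
    · have := (strip_rel_of_odd r h (q := 0) (by norm_num)).2.2.2 o b h2 ho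
      simp only [zero_mul, zero_add] at this ⊢
      rcases this with t | t | t
      exacts [comb a3 t, comb a1 t, comb a2 t]
    · have := (strip_rel_of_even r h (q := 1) (by norm_num)).2.2.2 o b h2 ho
      simp only [e1] at this ⊢
      rcases this with t | t | t
      exacts [comb b1 t, comb b2 t, comb b3 t]
    · have := (strip_rel_of_even r h (q := 2) (by norm_num)).2.2.2 o b h2 ho
      simp only [e2] at this ⊢
      rcases this with t | t | t
      exacts [comb c1 t, comb c2 t, comb c3 t]
    · have := (strip_rel_of_odd r h (q := 3) (by norm_num)).2.2.2 o b h2 ho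
      simp only [e3] at this ⊢
      rcases this with t | t | t
      exacts [comb d3 t, comb d1 t, comb d2 t]
  · have hb : b.val < 2 := ZMod.val_lt b
    refine ⟨⟨4 * q + 2 * o + b.val, by omega⟩, ?_⟩
    have : node k ⟨4 * q + 2 * o + b.val, by omega⟩ = pos k (q * (4 * k) + o) b := by
      apply node_eq
      · have h3 : (4 * q + 2 * o + b.val) / 4 = q := by omega
        have h4 : (4 * q + 2 * o + b.val) / 2 % 2 = o := by omega
        change _ = (4 * q + 2 * o + b.val) / 4 * (4 * k) + (4 * q + 2 * o + b.val) / 2 % 2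
        rw [h3, h4]
      · have h3 : (4 * q + 2 * o + b.val) % 2 = b.val := by omega
        change b = ((4 * q + 2 * o + b.val) % 2 : ℕ)
        rw [h3, ZMod.natCast_zmod_val]
    rw [this]

end Node

/-- The exchange of nodes turning the single cycle of `stepPerm` into two cycles. -/
def nodeTrade : Equiv.Perm (Fin 16) :=
  Equiv.swap 2 8 * Equiv.swap 6 13 * Equiv.swap 6 15

/-- The effect of `nodeTrade` on sums. -/
def nodeTradeSum : Equiv.Perm (Fin 16) :=
  Equiv.swap 8 13 * Equiv.swap 2 6 * Equiv.swap 2 15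

theorem sign_nodeTrade : Equiv.Perm.sign nodeTrade = -1 := by
  simp [nodeTrade, Equiv.Perm.sign_mul]

section Nodes

variable {k : ℕ} [NeZero k]

/-- Only the nodes 2, 6, 8, 13 and 15 are moved; their first coordinates agree up to multiples of
`16k`. -/
theorem nodeTrade_sums (i : Fin 16) :
    node k i + stepPerm k (node k (nodeTrade i)) =
      node k (nodeTradeSum i) + stepPerm k (node k (nodeTradeSum i)) := by
  have hk : 0 < k := Nat.pos_of_ne_zero (NeZero.ne k)
  have hz : (16 * k : ZMod (16 * k)) = 0 := by
    have : ((16 * k : ℕ) : ZMod (16 * k)) = 0 := ZMod.natCast_self _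
    exact_mod_cast this
  obtain ⟨-, -, n2, -, -, -, n6, -, n8, -, -, -, -, n13, -, n15⟩ := node_values (k := k)
  have s2 : stepPerm k (node k 2) = pos k 2 0 := by
    rw [n2, stepPerm_zero_short (by omega) (by unfold IsSwitched; omega)]
  have s6 : stepPerm k (node k 6) = pos k (4 * k + 2) 0 := by
    rw [n6, stepPerm_zero_short (by omega) (by unfold IsSwitched; omega)]
  have s8 : stepPerm k (node k 8) = pos k (8 * k + 2) 1 := by
    rw [n8, stepPerm_zero_long (by omega) (by unfold IsSwitched; omega)]
  have s13 : stepPerm k (node k 13) = pos k (12 * k + 2) 1 := by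
    rw [n13, stepPerm_one_long (by omega) (by unfold IsSwitched; omega)]
  have s15 : stepPerm k (node k 15) = pos k (12 * k + 2) 0 := by
    rw [n15, stepPerm_one_short (by omega) (by unfold IsSwitched; omega)]
  have key : i = 2 ∨ i = 6 ∨ i = 8 ∨ i = 13 ∨ i = 15 ∨ (nodeTrade i = i ∧ nodeTradeSum i = i) := by
    revert i; decide
  rcases key with rfl | rfl | rfl | rfl | rfl | ⟨h1, h2⟩
  · rw [show nodeTrade 2 = 8 by decide, show nodeTradeSum 2 = 15 by decide, s8, s15, n2, n15]
    simp only [pos, Prod.mk_add_mk, Prod.mk.injEq]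
    push_cast
    exact ⟨by linear_combination -hz, by decide⟩
  · rw [show nodeTrade 6 = 15 by decide, show nodeTradeSum 6 = 2 by decide, s15, s2, n6, n2]
    simp only [pos, Prod.mk_add_mk, Prod.mk.injEq]
    push_cast
    exact ⟨by linear_combination hz, by decide⟩
  · rw [show nodeTrade 8 = 2 by decide, show nodeTradeSum 8 = 13 by decide, s2, s13, n8, n13]
    simp only [pos, Prod.mk_add_mk, Prod.mk.injEq]
    push_cast
    exact ⟨by linear_combination -hz, by decide⟩
  · rw [show nodeTrade 13 = 6 by decide, show nodeTradeSum 13 = 8 by decide, s6, s8, n13, n8]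
    simp only [pos, Prod.mk_add_mk, Prod.mk.injEq]
    push_cast
    exact ⟨by linear_combination 0 * hz, by decide⟩
  · rw [show nodeTrade 15 = 13 by decide, show nodeTradeSum 15 = 6 by decide, s13, s6, n15, n6]
    simp only [pos, Prod.mk_add_mk, Prod.mk.injEq]
    push_cast
    exact ⟨by linear_combination hz, by decide⟩
  · rw [h1, h2]

end Nodes

theorem rel_of_iterate {α ι : Type*} (r : Setoid α) (f : ι → α) (e : ι → ι)
    (h : ∀ i, r (f i) (f (e i))) (i : ι) (n : ℕ) : r (f i) (f (e^[n] i)) := by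
  induction n with
  | zero => exact r.refl _
  | succ n ih => rw [Function.iterate_succ_apply']; exact r.trans ih (h _)

/-- Every point is connected to a node, so cycles can be counted on nodes: the orbit of node 0 under
`nextNode` is everything, while after the trade nodes 0 and 7 together reach everything. So `G` has
at most two cycles, and the odd sign of the trade rules out one. -/
theorem isSplittable_zmod_sixteen_mul (k : ℕ) [NeZero k] :
    IsSplittable (ZMod (16 * k) × ZMod 2) := by
  classical
  have hk : 0 < k := Nat.pos_of_ne_zero (NeZero.ne k)
  have hc : ∀ x y, (stepPerm k).SameCycle x y := by
    let r := Equiv.Perm.SameCycle.setoid (stepPerm k)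
    have hr : ∀ x, r x (stepPerm k x) := sameCycle_step _
    have hnode : ∀ i, r (node k 0) (node k i) := by
      intro i
      have : ∀ i : Fin 16, ∃ n : Fin 16, nextNode^[n] 0 = i := by decide
      obtain ⟨n, hn⟩ := this i
      rw [← hn]
      exact rel_of_iterate r (node k) nextNode
        (fun i => r.trans (hr _) (rel_nextNode r (fun q _ o _ _ b => hr _) i)) 0 n
    have all : ∀ x, r (node k 0) x := by
      intro x
      obtain ⟨i, hi⟩ := exists_rel_node r (fun q _ o _ _ b => hr _) x
      exact r.trans (hnode i) hi
    exact fun x y => r.trans (r.symm (all x)) (all y)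
  obtain ⟨G, hG, hGn, hGo, hsign⟩ := (isCompleteMapping_stepPerm (k := k)).exists_trade
    ⟨node k, node_injective⟩ nodeTrade nodeTradeSum nodeTrade_sums
  let r := Equiv.Perm.SameCycle.setoid G
  have hr : ∀ x, r x (G x) := sameCycle_step _
  have hbulk : ∀ q < 4, ∀ o, 2 ≤ o → o < 4 * k → ∀ b,
      r (pos k (q * (4 * k) + o) b) (stepPerm k (pos k (q * (4 * k) + o) b)) := by
    intro q hq o h2 ho b
    rw [← hGo _ (not_mem_range_node hq h2 ho b)]
    exact hr _
  have hnode : ∀ i, r (node k 0) (node k i) ∨ r (node k 7) (node k i) := by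
    intro i
    have key : ∀ i : Fin 16, (∃ n : Fin 16, (nextNode ∘ nodeTrade)^[n] 0 = i) ∨
        ∃ n : Fin 16, (nextNode ∘ nodeTrade)^[n] 7 = i := by decide
    have step : ∀ i, r (node k i) (node k ((nextNode ∘ nodeTrade) i)) := by
      intro i
      have h1 := hr (node k i)
      have h2 : G (node k i) = stepPerm k (node k (nodeTrade i)) := hGn i
      rw [h2] at h1
      exact r.trans h1 (rel_nextNode r hbulk (nodeTrade i))
    refine (key i).imp ?_ ?_
    all_goals
      rintro ⟨n, rfl⟩
      exact rel_of_iterate r (node k) _ step _ n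
  obtain ⟨n0, -, n2, -⟩ := node_values (k := k)
  have htwo : stepPerm k (stepPerm k (node k 0)) = pos k 2 0 := by
    rw [n0, stepPerm_zero_short (by omega) (by unfold IsSwitched; omega),
      stepPerm_zero_short (by omega) (by unfold IsSwitched; omega)]
  -- The second iterate of node 0 is the start of the strand that ends at node 7, so it represents
  -- the second cycle.
  have h7 : r (stepPerm k (stepPerm k (node k 0))) (node k 7) := by
    rw [htwo]
    exact (strip_ends r hbulk).1.2.2
  have hall : ∀ x, r (node k 0) x ∨ r (stepPerm k (stepPerm k (node k 0))) x := by
    intro x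
    obtain ⟨i, hi⟩ := exists_rel_node r hbulk x
    exact (hnode i).imp (fun h => r.trans h hi) (fun h => r.trans h7 (r.trans h hi))
  refine ⟨stepPerm k, G, isCompleteMapping_stepPerm, hG, hc, node k 0, ?_, hall⟩
  intro hrel
  have hrel' : r (node k 0) (stepPerm k (stepPerm k (node k 0))) := hrel
  have tr : ∀ x, r (node k 0) x := fun x => (hall x).elim id (fun h => r.trans hrel' h)
  -- If both representatives were on one cycle, `G` and `stepPerm` would be single cycles with
  -- opposite signs.
  have hGc : ∀ x y, G.SameCycle x y := fun x y => r.trans (r.symm (tr x)) (tr y)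
  have h1 := hsign
  rw [sign_of_sameCycle hGc, sign_of_sameCycle hc, sign_nodeTrade] at h1
  have h2 : ∀ a : ℤˣ, a ≠ a * -1 := by decide
  exact h2 _ h1

/-! ### Ample groups and the structure theorem -/

/-- `K` has at least two involutions and is not an elementary abelian `2`-group. -/
def IsAmple (K : Type*) [AddCommGroup K] : Prop :=
  (∃ a b : K, a ≠ 0 ∧ b ≠ 0 ∧ a ≠ b ∧ a + a = 0 ∧ b + b = 0) ∧ ∃ x : K, x + x ≠ 0

theorem IsAmple.of_injective {K L : Type*} [AddCommGroup K] [AddCommGroup L] (f : K →+ L)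
    (hf : Function.Injective f) (h : IsAmple K) : IsAmple L := by
  obtain ⟨⟨a, b, ha, hb, hab, ha2, hb2⟩, x, hx⟩ := h
  refine ⟨⟨f a, f b, ?_, ?_, hf.ne hab, ?_, ?_⟩, f x, ?_⟩
  · exact fun h => ha (hf (h.trans f.map_zero.symm))
  · exact fun h => hb (hf (h.trans f.map_zero.symm))
  · rw [← map_add, ha2, map_zero]
  · rw [← map_add, hb2, map_zero]
  · rw [← map_add]
    exact fun h => hx (hf (h.trans f.map_zero.symm))

/-- The structure theorem without trivial factors. -/
theorem exists_addEquiv_pi_zmod (K : Type*) [AddCommGroup K] [Finite K] :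
    ∃ (ι : Type) (_ : Fintype ι) (p e : ι → ℕ), (∀ i, (p i).Prime) ∧ (∀ i, e i ≠ 0) ∧
      Nonempty (K ≃+ ∀ i, ZMod (p i ^ e i)) := by
  classical
  obtain ⟨ι, _, p, hp, e, ⟨f⟩⟩ := AddCommGroup.equiv_directSum_zmod_of_finite K
  let g : (∀ i, ZMod (p i ^ e i)) →+ ∀ i : {i // e i ≠ 0}, ZMod (p i ^ e i) :=
    { toFun := fun x i => x i, map_zero' := rfl, map_add' := fun _ _ => rfl }
  have hg : Function.Bijective g := by
    constructor
    · intro x y h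
      funext i
      by_cases hi : e i = 0
      · have : Subsingleton (ZMod (p i ^ e i)) := by
          rw [hi, pow_zero]; infer_instance
        exact Subsingleton.elim _ _
      · exact congrFun h ⟨i, hi⟩
    · intro y
      refine ⟨fun i => if h : e i ≠ 0 then y ⟨i, h⟩ else 0, ?_⟩
      funext i
      exact dif_pos i.2
  exact ⟨{i // e i ≠ 0}, inferInstance, fun i => p i, fun i => e i, fun i => hp i, fun i => i.2,
    ⟨(f.trans (DirectSum.addEquivProd _)).trans (AddEquiv.ofBijective g hg)⟩⟩

theorem card_ker_lt {K Q : Type*} [AddCommGroup K] [Finite K] [AddCommGroup Q] [Nontrivial Q]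
    (π : K →+ Q) (hπ : Function.Surjective π) : Nat.card π.ker < Nat.card K := by
  refine lt_of_le_of_ne (AddSubgroup.card_le_card_addGroup _) fun h => ?_
  obtain ⟨q, hq⟩ := exists_ne (0 : Q)
  obtain ⟨x, rfl⟩ := hπ q
  have : x ∈ π.ker := by rw [AddSubgroup.eq_top_of_card_eq _ h]; trivial
  exact hq this

/-! ### Splitting off parities of coordinates -/

section Coordinates

variable {ι : Type} {n : ι → ℕ}

/-- The reduction of two coordinates modulo `2`. -/
def parityHom {i j : ι} (hi : 2 ∣ n i) (hj : 2 ∣ n j) :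
    (∀ l, ZMod (n l)) →+ ZMod 2 × ZMod 2 :=
  ((ZMod.castHom hi (ZMod 2)).toAddMonoidHom.comp (Pi.evalAddMonoidHom _ i)).prod
    ((ZMod.castHom hj (ZMod 2)).toAddMonoidHom.comp (Pi.evalAddMonoidHom _ j))

theorem parityHom_apply {i j : ι} (hi : 2 ∣ n i) (hj : 2 ∣ n j) (x : ∀ l, ZMod (n l)) :
    parityHom hi hj x = (ZMod.castHom hi (ZMod 2) (x i), ZMod.castHom hj (ZMod 2) (x j)) := rfl

variable [DecidableEq ι]

/-- The element whose only nonzero coordinate is `c` at `i`. -/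
def coord (n : ι → ℕ) (i : ι) (c : ℕ) : ∀ l, ZMod (n l) := Pi.single i (c : ZMod (n i))

theorem coord_same (i : ι) (c : ℕ) : coord n i c i = c := Pi.single_eq_same _ _

theorem coord_of_ne {i l : ι} (h : l ≠ i) (c : ℕ) : coord n i c l = 0 := Pi.single_eq_of_ne h _

theorem coord_eq_zero_iff {i : ι} {c : ℕ} : coord n i c = 0 ↔ n i ∣ c := by
  rw [coord, Pi.single_eq_zero_iff, ZMod.natCast_eq_zero_iff]

theorem coord_add_self (i : ι) (c : ℕ) : coord n i c + coord n i c = coord n i (2 * c) := by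
  rw [coord, ← Pi.single_add, coord, Nat.cast_mul, Nat.cast_two, two_mul]

theorem coord_ne_coord {i l : ι} {c : ℕ} (h : i ≠ l) (d : ℕ) (hc : ¬ n i ∣ c) :
    coord n i c ≠ coord n l d := by
  intro he
  have := congrFun he i
  rw [coord_same, coord_of_ne h, ZMod.natCast_eq_zero_iff] at this
  exact hc this

theorem parityHom_coord {i j l : ι} (hi : 2 ∣ n i) (hj : 2 ∣ n j) {c : ℕ}
    (h : l = i ∨ l = j → 2 ∣ c) : parityHom hi hj (coord n l c) = 0 := by
  rw [parityHom_apply]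
  have key : ∀ {m : ι} (hm : 2 ∣ n m), (l = m → 2 ∣ c) →
      ZMod.castHom hm (ZMod 2) (coord n l c m) = 0 := by
    intro m hm hlm
    by_cases h : l = m
    · subst h
      rw [coord_same, map_natCast, ZMod.natCast_eq_zero_iff]
      exact hlm rfl
    · rw [coord_of_ne (Ne.symm h), map_zero]
  rw [key hi fun h' => h (Or.inl h'), key hj fun h' => h (Or.inr h')]
  rfl

theorem parityHom_surjective {i j : ι} (hij : i ≠ j) (hi : 2 ∣ n i) (hj : 2 ∣ n j) :
    Function.Surjective (parityHom hi hj) := by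
  rintro ⟨a, b⟩
  refine ⟨coord n i a.val + coord n j b.val, ?_⟩
  rw [parityHom_apply, Pi.add_apply, Pi.add_apply, coord_same, coord_same, coord_of_ne hij,
    coord_of_ne hij.symm, add_zero, zero_add, map_natCast, map_natCast, ZMod.natCast_zmod_val,
    ZMod.natCast_zmod_val]

/-- Splitting off two even coordinates, the kernel of their parities being ample. -/
theorem isSplittable_of_parityHom [Finite ι] [∀ i, NeZero (n i)]
    (ih : ∀ (K : Type) [AddCommGroup K] [Finite K], Nat.card K < Nat.card (∀ l, ZMod (n l)) →
      IsAmple K → IsSplittable K)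
    {i j k l m : ι} (c : ℕ) (hij : i ≠ j) (hi : 2 ∣ n i) (hj : 2 ∣ n j) (hkl : k ≠ l)
    (hk : 2 ∣ n k) (hl : 2 ∣ n l) (hk4 : k = i ∨ k = j → 4 ∣ n k) (hl4 : l = i ∨ l = j → 4 ∣ n l)
    (hc : m = i ∨ m = j → 2 ∣ c) (hm : ¬ n m ∣ 2 * c) : IsSplittable (∀ l, ZMod (n l)) := by
  have hsurj := parityHom_surjective hij hi hj
  refine IsSplittable.of_klein_quotient (parityHom hi hj) hsurj
    (ih _ (card_ker_lt _ hsurj) ⟨?_, ?_⟩)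
  · have half : ∀ k, 2 ∣ n k → ¬ n k ∣ n k / 2 := by
      intro k hk h
      have h0 : 0 < n k := Nat.pos_of_ne_zero (NeZero.ne _)
      have := Nat.le_of_dvd (by omega) h
      omega
    have hz : ∀ k, 2 ∣ n k → coord n k (n k / 2) + coord n k (n k / 2) = 0 := by
      intro k hk
      rw [coord_add_self, coord_eq_zero_iff, Nat.mul_div_cancel' hk]
    -- The involutions are half the modulus at `k` and at `l`. At a coordinate whose parity is
    -- tested, divisibility by 4 makes that half even, hence in the kernel.
    refine ⟨⟨coord n k (n k / 2), parityHom_coord hi hj fun h => ?_⟩,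
      ⟨coord n l (n l / 2), parityHom_coord hi hj fun h => ?_⟩, ?_, ?_, ?_, ?_, ?_⟩
    · have := hk4 h; omega
    · have := hl4 h; omega
    · exact fun h => half k hk (coord_eq_zero_iff.1 (congrArg Subtype.val h))
    · exact fun h => half l hl (coord_eq_zero_iff.1 (congrArg Subtype.val h))
    · exact fun h => coord_ne_coord hkl _ (half k hk) (congrArg Subtype.val h)
    · exact Subtype.ext (hz k hk)
    · exact Subtype.ext (hz l hl)
  · refine ⟨⟨coord n m c, parityHom_coord hi hj hc⟩, fun h => hm ?_⟩
    have := congrArg Subtype.val h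
    rw [← coord_eq_zero_iff, ← coord_add_self]
    exact this

/-- Two involutions force two even coordinates. -/
theorem exists_even_ne [∀ i, NeZero (n i)] (h : IsAmple (∀ l, ZMod (n l))) (m : ι) :
    ∃ l, l ≠ m ∧ 2 ∣ n l := by
  obtain ⟨⟨a, b, ha, hb, hab, ha2, hb2⟩, -⟩ := h
  by_contra! hodd
  -- If every modulus but that of `m` is odd, an involution is concentrated at `m` and equals half
  -- the modulus there, so there is at most one.
  have inv : ∀ (l : ι) (z : ZMod (n l)), z + z = 0 → z = 0 ∨ 2 * z.val = n l := fun l z hz =>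
    (ZMod.neg_eq_self_iff z).1 (neg_eq_of_add_eq_zero_left hz)
  have zero : ∀ x : ∀ l, ZMod (n l), x + x = 0 → ∀ l, l ≠ m → x l = 0 := by
    intro x hx l hl
    rcases inv l (x l) (congrFun hx l) with h | h
    · exact h
    · exact absurd ⟨_, h.symm⟩ (hodd l hl)
  have ne : ∀ x : ∀ l, ZMod (n l), x ≠ 0 → x + x = 0 → 2 * (x m).val = n m := by
    intro x h0 hx
    rcases inv m (x m) (congrFun hx m) with h | h
    · refine absurd ?_ h0
      funext l
      by_cases hl : l = m
      · rw [hl]; exact h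
      · exact zero x hx l hl
    · exact h
  apply hab
  funext l
  by_cases hl : l = m
  · subst hl
    apply ZMod.val_injective
    have := ne a ha ha2
    have := ne b hb hb2
    omega
  · rw [zero a ha2 l hl, zero b hb2 l hl]

end Coordinates

/-! ### Base cases of the induction -/

section Bases

/-- The kernel of the projection onto the first factor of a product. -/
def kerFstEquiv (A B : Type*) [AddCommGroup A] [AddCommGroup B] :
    B ≃+ (AddMonoidHom.fst A B).ker where
  toFun b := ⟨(0, b), rfl⟩
  invFun x := x.1.2
  left_inv _ := rfl
  right_inv x := Subtype.ext (Prod.ext (x.2 : x.1.1 = 0).symm rfl)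
  map_add' _ _ := Subtype.ext (Prod.ext (add_zero 0).symm rfl)

theorem isSplittable_klein_prod_prime (p : ℕ) [hp : Fact p.Prime] (h2 : p ≠ 2) :
    IsSplittable (ZMod 2 × ZMod 2 × ZMod p) := by
  by_cases h3 : p = 3
  · subst h3
    exact isSplittable_zmod_2_2_3
  have h5 : 5 ≤ p := by
    have := hp.out.two_le
    have h4 : p ≠ 4 := by rintro rfl; exact absurd hp.out (by decide)
    omega
  have h : IsSplittable ((ZMod 2 × ZMod 2) × ZMod p) :=
    IsSplittable.of_klein_quotient (AddMonoidHom.fst _ _) Prod.fst_surjective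
      ((isSplittable_zmod_prime p h5).of_addEquiv (kerFstEquiv _ _))
  exact h.of_addEquiv AddEquiv.prodAssoc

theorem isSplittable_octo_prod_prime (p : ℕ) [hp : Fact p.Prime] (h2 : p ≠ 2) :
    IsSplittable (ZMod 2 × ZMod 2 × ZMod 2 × ZMod p) := by
  by_cases h3 : p = 3
  · subst h3
    exact isSplittable_zmod_2_2_2_3
  have h5 : 5 ≤ p := by
    have := hp.out.two_le
    have h4 : p ≠ 4 := by rintro rfl; exact absurd hp.out (by decide)
    omega
  have hodd : Odd (Nat.card (AddMonoidHom.fst (ZMod 2 × ZMod 2 × ZMod 2) (ZMod p)).ker) := by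
    rw [← Nat.card_congr (kerFstEquiv (ZMod 2 × ZMod 2 × ZMod 2) (ZMod p)).toEquiv, Nat.card_zmod]
    exact hp.out.odd_of_ne_two h2
  have h : IsSplittable ((ZMod 2 × ZMod 2 × ZMod 2) × ZMod p) :=
    IsSplittable.of_octo_quotient (AddMonoidHom.fst _ _) Prod.fst_surjective hodd
      ((isSplittable_zmod_prime p h5).of_addEquiv (kerFstEquiv _ _))
  exact h.of_addEquiv (AddEquiv.prodAssoc.trans
    ((AddEquiv.refl _).prodCongr AddEquiv.prodAssoc))

theorem isSplittable_two_prod_two_pow {b : ℕ} (hb : 2 ≤ b) :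
    IsSplittable (ZMod 2 × ZMod (2 ^ b)) := by
  rcases Nat.lt_or_ge b 4 with h | h
  · interval_cases b
    · exact isSplittable_zmod_2_4
    · exact isSplittable_zmod_2_8
  · obtain ⟨c, rfl⟩ := Nat.exists_eq_add_of_le h
    have : NeZero (2 ^ c) := ⟨by positivity⟩
    rw [pow_add]
    exact (isSplittable_zmod_sixteen_mul (2 ^ c)).of_addEquiv AddEquiv.prodComm

end Bases

/-! ### Products of few factors -/

section FewFactors

variable {ι : Type*} [DecidableEq ι] {M : ι → Type*} [∀ i, AddCommGroup (M i)]

/-- A product over an index type with two elements. -/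
noncomputable def piEquivTwo {i j : ι} (hij : i ≠ j) (h : ∀ l, l = i ∨ l = j) :
    (∀ l, M l) ≃+ M i × M j :=
  AddEquiv.ofBijective ((Pi.evalAddMonoidHom M i).prod (Pi.evalAddMonoidHom M j)) (by
    constructor
    · intro x y hxy
      funext l
      rcases h l with rfl | rfl
      exacts [congrArg Prod.fst hxy, congrArg Prod.snd hxy]
    · rintro ⟨a, b⟩
      exact ⟨Pi.single i a + Pi.single j b, by simp [hij, hij.symm]⟩)

/-- A product over an index type with three elements. -/
noncomputable def piEquivThree {i j k : ι} (hij : i ≠ j) (hik : i ≠ k) (hjk : j ≠ k)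
    (h : ∀ l, l = i ∨ l = j ∨ l = k) : (∀ l, M l) ≃+ M i × M j × M k :=
  AddEquiv.ofBijective ((Pi.evalAddMonoidHom M i).prod
      ((Pi.evalAddMonoidHom M j).prod (Pi.evalAddMonoidHom M k))) (by
    constructor
    · intro x y hxy
      funext l
      rcases h l with rfl | rfl | rfl
      exacts [congrArg Prod.fst hxy, congrArg (fun p => p.2.1) hxy, congrArg (fun p => p.2.2) hxy]
    · rintro ⟨a, b, c⟩
      exact ⟨Pi.single i a + Pi.single j b + Pi.single k c, by
        simp [hij, hij.symm, hik, hik.symm, hjk, hjk.symm]⟩)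

/-- A product over an index type with four elements. -/
noncomputable def piEquivFour {i j k m : ι} (hij : i ≠ j) (hik : i ≠ k) (him : i ≠ m) (hjk : j ≠ k)
    (hjm : j ≠ m) (hkm : k ≠ m) (h : ∀ l, l = i ∨ l = j ∨ l = k ∨ l = m) :
    (∀ l, M l) ≃+ M i × M j × M k × M m :=
  AddEquiv.ofBijective ((Pi.evalAddMonoidHom M i).prod ((Pi.evalAddMonoidHom M j).prod
      ((Pi.evalAddMonoidHom M k).prod (Pi.evalAddMonoidHom M m)))) (by
    constructor
    · intro x y hxy
      funext l
      rcases h l with rfl | rfl | rfl | rfl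
      exacts [congrArg Prod.fst hxy, congrArg (fun p => p.2.1) hxy,
        congrArg (fun p => p.2.2.1) hxy, congrArg (fun p => p.2.2.2) hxy]
    · rintro ⟨a, b, c, d⟩
      exact ⟨Pi.single i a + Pi.single j b + Pi.single k c + Pi.single m d, by
        simp [hij, hij.symm, hik, hik.symm, hjk, hjk.symm, him, him.symm, hjm, hjm.symm, hkm,
          hkm.symm]⟩)

end FewFactors

/-- Cyclic groups of equal order. -/
def zmodCongr {a b : ℕ} (h : a = b) : ZMod a ≃+ ZMod b := (ZMod.ringEquivCongr h).toAddEquiv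

/-! ### The case of 2-groups -/

section TwoGroup

variable {ι : Type} [Fintype ι] [DecidableEq ι] {n : ι → ℕ} [∀ i, NeZero (n i)]

/-- Ample `2`-groups, granted the result for smaller groups. -/
theorem isSplittable_two_group (hn : ∀ i, ∃ e, e ≠ 0 ∧ n i = 2 ^ e)
    (h : IsAmple (∀ l, ZMod (n l)))
    (ih : ∀ (K : Type) [AddCommGroup K] [Finite K], Nat.card K < Nat.card (∀ l, ZMod (n l)) →
      IsAmple K → IsSplittable K) : IsSplittable (∀ l, ZMod (n l)) := by
  have even : ∀ i, 2 ∣ n i := by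
    intro i
    obtain ⟨e, he, h⟩ := hn i
    rw [h]; exact dvd_pow_self 2 he
  have four : ∀ i, n i = 2 ∨ 4 ∣ n i := by
    intro i
    obtain ⟨e, he, h⟩ := hn i
    rcases e with _ | _ | e
    · exact absurd rfl he
    · left; rw [h]; rfl
    · right; rw [h]; exact ⟨2 ^ e, by ring⟩
  have eight : ∀ i, 4 ∣ n i → n i = 4 ∨ ¬ n i ∣ 2 * 2 := by
    intro i h4
    have h0 := NeZero.ne (n i)
    by_cases h : n i ∣ 2 * 2
    · left
      exact Nat.dvd_antisymm h h4
    · exact Or.inr h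
  have not_two : ∀ i, 4 ∣ n i → ¬ n i ∣ 2 * 1 := by
    intro i h4 h
    exact absurd (Nat.le_of_dvd (by norm_num) (h4.trans h)) (by norm_num)
  -- Otherwise every factor is `Z_2` and all doubles vanish.
  obtain ⟨m, hm⟩ : ∃ m, 4 ∣ n m := by
    obtain ⟨x, hx⟩ := h.2
    by_contra! hno
    apply hx
    funext l
    have hl := (four l).resolve_right (hno l)
    have h2 : ((2 : ℕ) : ZMod (n l)) = 0 := (ZMod.natCast_eq_zero_iff _ _).2 (by rw [hl])
    change x l + x l = 0
    rw [← two_mul, ← Nat.cast_two, h2, zero_mul]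
  obtain ⟨l, hlm, -⟩ := exists_even_ne h m
  have hcard : (Finset.univ.erase m).card ≠ 0 :=
    Finset.card_ne_zero_of_mem (Finset.mem_erase.2 ⟨hlm, Finset.mem_univ l⟩)
  -- With at least three further factors, two are reduced to their even parts while a third and the
  -- `m`-th stay intact, which keeps the kernel ample. With fewer, the exceptions are `Z_2 ⊕ Z_2 ⊕
  -- Z_4`, `Z_4 ⊕ Z_4` and `Z_2 ⊕ Z_{2^b}`.
  rcases Nat.lt_or_ge 2 (Finset.univ.erase m).card with h3 | h2
  · obtain ⟨i, j, k, hi, hj, hk, hij, hik, hjk⟩ := Finset.two_lt_card_iff.1 h3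
    have hi := (Finset.mem_erase.1 hi).1
    have hj := (Finset.mem_erase.1 hj).1
    have hk := (Finset.mem_erase.1 hk).1
    exact isSplittable_of_parityHom (k := k) (l := m) (m := m) ih 1 hij (even i) (even j) hk
      (even k) (even m) (by tauto) (fun _ => hm) (by tauto) (not_two m hm)
  rcases (show (Finset.univ.erase m).card = 2 ∨ (Finset.univ.erase m).card = 1 by omega) with h2 | h1
  · obtain ⟨i, j, hij, hs⟩ := Finset.card_eq_two.1 h2
    have hmem : ∀ l, l ≠ m ↔ l = i ∨ l = j := by
      intro l
      have := Finset.ext_iff.1 hs l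
      simpa using this
    have him : i ≠ m := (hmem i).2 (Or.inl rfl)
    have hjm : j ≠ m := (hmem j).2 (Or.inr rfl)
    rcases four i with hi | hi
    · rcases four j with hj | hj
      · rcases eight m hm with h4 | h8
        · refine isSplittable_zmod_2_2_4.of_addEquiv (AddEquiv.symm ?_)
          exact (piEquivThree hij him hjm fun l => by have := hmem l; tauto).trans
            ((zmodCongr hi).prodCongr ((zmodCongr hj).prodCongr (zmodCongr h4)))
        · exact isSplittable_of_parityHom (k := j) (l := m) (m := m) ih 2 him (even i) (even m) hjm
            (even j) (even m) (by rintro (h | h) <;> [exact absurd h.symm hij; exact absurd h hjm])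
            (fun _ => hm) (fun _ => dvd_rfl) h8
      · exact isSplittable_of_parityHom (k := j) (l := m) (m := m) ih 1 hij (even i) (even j) hjm
          (even j) (even m) (fun _ => hj) (fun _ => hm)
          (by rintro (h | h) <;> [exact absurd h.symm him; exact absurd h.symm hjm]) (not_two m hm)
    · exact isSplittable_of_parityHom (k := i) (l := m) (m := m) ih 1 hij (even i) (even j) him
        (even i) (even m) (fun _ => hi) (fun _ => hm)
        (by rintro (h | h) <;> [exact absurd h.symm him; exact absurd h.symm hjm]) (not_two m hm)
  · obtain ⟨i, hs⟩ := Finset.card_eq_one.1 h1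
    have hmem : ∀ l, l ≠ m ↔ l = i := by
      intro l
      have := Finset.ext_iff.1 hs l
      simpa using this
    have him : i ≠ m := (hmem i).2 rfl
    have e := piEquivTwo (M := fun l => ZMod (n l)) him fun l => by have := hmem l; tauto
    rcases four i with hi | hi
    · obtain ⟨b, hb, hmb⟩ := hn m
      have hb2 : 2 ≤ b := by
        by_contra hlt
        have : b = 1 := by omega
        subst this
        rw [hmb] at hm
        exact absurd hm (by decide)
      exact (isSplittable_two_prod_two_pow hb2).of_addEquiv
        (e.trans ((zmodCongr hi).prodCongr (zmodCongr hmb))).symm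
    · rcases eight m hm with h4 | h8
      · rcases eight i hi with hi4 | hi8
        · exact isSplittable_zmod_4_4.of_addEquiv
            (e.trans ((zmodCongr hi4).prodCongr (zmodCongr h4))).symm
        · exact isSplittable_of_parityHom (k := i) (l := m) (m := i) ih 2 him (even i) (even m) him
            (even i) (even m) (fun _ => hi) (fun _ => hm) (fun _ => dvd_rfl) hi8
      · exact isSplittable_of_parityHom (k := i) (l := m) (m := m) ih 2 him (even i) (even m) him
          (even i) (even m) (fun _ => hi) (fun _ => hm) (fun _ => dvd_rfl) h8

end TwoGroup

/-- Quotients of ample groups by a cyclic group of odd order remain ample, unless all doubles lie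
in the subgroup. -/
theorem IsAmple.quotient {K : Type*} [AddCommGroup K] [Finite K] (h : IsAmple K)
    {N : AddSubgroup K} (hN : Odd (Nat.card N)) {x : K} (hx : x + x ∉ N) : IsAmple (K ⧸ N) := by
  obtain ⟨⟨a, b, ha, hb, hab, ha2, hb2⟩, -⟩ := h
  -- A subgroup of odd order contains no involution, so `a`, `b` and their difference survive in the
  -- quotient.
  have key : ∀ z ∈ N, z + z = 0 → z = 0 := by
    intro z hz h2
    have h := isCompleteMapping_addRight hN 0
    have : (⟨z, hz⟩ : N) = 0 := h.1 (by
      apply Subtype.ext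
      change z + (z + 0) = 0 + (0 + 0)
      rw [add_zero, h2]; simp)
    exact congrArg Subtype.val this
  refine ⟨⟨(a : K ⧸ N), (b : K ⧸ N), ?_, ?_, ?_, ?_, ?_⟩, (x : K ⧸ N), ?_⟩
  · exact fun h => ha (key a ((QuotientAddGroup.eq_zero_iff a).1 h) ha2)
  · exact fun h => hb (key b ((QuotientAddGroup.eq_zero_iff b).1 h) hb2)
  · intro h
    have h1 : -a + b ∈ N := QuotientAddGroup.eq.1 h
    have h2 : -a + b + (-a + b) = 0 := by
      have : -a + b + (-a + b) = -(a + a) + (b + b) := by abel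
      rw [this, ha2, hb2]; simp
    exact hab (neg_add_eq_zero.1 (key _ h1 h2))
  · rw [← QuotientAddGroup.mk_add, ha2]; rfl
  · rw [← QuotientAddGroup.mk_add, hb2]; rfl
  · rw [← QuotientAddGroup.mk_add]
    exact fun h => hx ((QuotientAddGroup.eq_zero_iff _).1 h)

/-! ### Elementary abelian 2-groups times a group of odd prime order -/

section OddFactor

variable {ι : Type} [Fintype ι] [DecidableEq ι] {n : ι → ℕ} [∀ i, NeZero (n i)]

/-- Ample groups whose doubles all lie in a factor of odd prime order. -/
theorem isSplittable_elementary_prod_prime {i₀ : ι} [hp : Fact (n i₀).Prime] (h2 : n i₀ ≠ 2)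
    (hn : ∀ i, i ≠ i₀ → n i = 2) (h : IsAmple (∀ l, ZMod (n l)))
    (ih : ∀ (K : Type) [AddCommGroup K] [Finite K], Nat.card K < Nat.card (∀ l, ZMod (n l)) →
      IsAmple K → IsSplittable K) : IsSplittable (∀ l, ZMod (n l)) := by
  have hodd : ¬ 2 ∣ n i₀ := fun hd => h2 ((Nat.prime_dvd_prime_iff_eq Nat.prime_two hp.out).1 hd).symm
  obtain ⟨a, ha, -⟩ := exists_even_ne h i₀
  obtain ⟨b, hba, hb2⟩ := exists_even_ne h a
  have hb : b ≠ i₀ := fun hh => hodd (hh ▸ hb2)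
  have even : ∀ i, i ≠ i₀ → 2 ∣ n i := fun i hi => by rw [hn i hi]
  by_cases h2a : ∀ l, l = a ∨ l = b ∨ l = i₀
  · exact (isSplittable_klein_prod_prime (n i₀) h2).of_addEquiv
      ((piEquivThree (M := fun l => ZMod (n l)) hba.symm ha hb h2a).trans
        ((zmodCongr (hn a ha)).prodCongr ((zmodCongr (hn b hb)).prodCongr (AddEquiv.refl _)))).symm
  push Not at h2a
  obtain ⟨c, hca, hcb, hc⟩ := h2a
  by_cases h3a : ∀ l, l = a ∨ l = b ∨ l = c ∨ l = i₀
  · exact (isSplittable_octo_prod_prime (n i₀) h2).of_addEquiv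
      ((piEquivFour (M := fun l => ZMod (n l)) hba.symm hca.symm ha hcb.symm hb hc h3a).trans
        ((zmodCongr (hn a ha)).prodCongr ((zmodCongr (hn b hb)).prodCongr
          ((zmodCongr (hn c hc)).prodCongr (AddEquiv.refl _))))).symm
  push Not at h3a
  obtain ⟨d, hda, hdb, hdc, hd⟩ := h3a
  -- With four factors `Z_2`, removing two leaves two involutions and the odd factor.
  refine isSplittable_of_parityHom (k := c) (l := d) (m := i₀) ih 1 hba.symm (even a ha) (even b hb)
    hdc.symm (even c hc) (even d hd) (by tauto) (by tauto) (by tauto) ?_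
  intro hdvd
  rw [mul_one, Nat.prime_dvd_prime_iff_eq hp.out Nat.prime_two] at hdvd
  exact h2 hdvd

end OddFactor

/-! ### The induction and the main theorem -/

/-- An abelian group with two involutions that is not an elementary abelian `2`-group is
splittable. -/
theorem IsAmple.isSplittable {K : Type} [AddCommGroup K] [Finite K] (h : IsAmple K) :
    IsSplittable K := by
  classical
  obtain ⟨N, hN⟩ : ∃ N, Nat.card K = N := ⟨_, rfl⟩
  induction N using Nat.strong_induction_on generalizing K with
  | _ N ih =>
  obtain ⟨ι, _, p, e, hp, he, ⟨f⟩⟩ := exists_addEquiv_pi_zmod K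
  have hne : ∀ i, NeZero (p i ^ e i) := fun i => ⟨pow_ne_zero _ (hp i).ne_zero⟩
  suffices IsSplittable (∀ i, ZMod (p i ^ e i)) from this.of_addEquiv f.symm
  replace h := h.of_injective f.toAddMonoidHom f.injective
  rw [Nat.card_congr f.toEquiv] at hN
  have ih' : ∀ (K : Type) [AddCommGroup K] [Finite K],
      Nat.card K < Nat.card (∀ i, ZMod (p i ^ e i)) → IsAmple K → IsSplittable K :=
    fun K _ _ hK hA => ih _ (hN ▸ hK) hA rfl
  by_cases htwo : ∀ i, p i = 2
  · exact isSplittable_two_group (fun i => ⟨e i, he i, by rw [htwo i]⟩) h ih'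
  push Not at htwo
  obtain ⟨i₀, hi₀⟩ := htwo
  set n : ι → ℕ := fun i => p i ^ e i with hn
  have hp₀ := hp i₀
  -- A generator of the subgroup of order `p i₀` in the `i₀`-th factor.
  let g : ∀ l, ZMod (n l) := coord n i₀ (p i₀ ^ (e i₀ - 1))
  have hpe : p i₀ * p i₀ ^ (e i₀ - 1) = p i₀ ^ e i₀ := by
    rw [← pow_succ', Nat.sub_add_cancel (Nat.pos_of_ne_zero (he i₀))]
  have hpg : p i₀ • g = 0 := by
    change p i₀ • (Pi.single i₀ ((p i₀ ^ (e i₀ - 1) : ℕ) : ZMod (n i₀)) : ∀ l, ZMod (n l)) = 0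
    rw [← Pi.single_smul, nsmul_eq_mul, ← Nat.cast_mul, hpe]
    change (Pi.single i₀ ((n i₀ : ℕ) : ZMod (n i₀)) : ∀ l, ZMod (n l)) = 0
    rw [ZMod.natCast_self, Pi.single_zero]
  have hg0 : g ≠ 0 := by
    intro hz
    have h1 : p i₀ ^ e i₀ ∣ p i₀ ^ (e i₀ - 1) :=
      (coord_eq_zero_iff (n := n)).1 hz
    have h2 := (Nat.pow_dvd_pow_iff_le_right hp₀.one_lt).1 h1
    have := he i₀
    omega
  have hcardN : Odd (Nat.card (AddSubgroup.zmultiples g)) := by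
    rw [Nat.card_zmultiples]
    exact (hp₀.odd_of_ne_two hi₀).of_dvd_nat (addOrderOf_dvd_of_nsmul_eq_zero hpg)
  by_cases hx : ∃ x : ∀ l, ZMod (n l), x + x ∉ AddSubgroup.zmultiples g
  · obtain ⟨x, hx⟩ := hx
    have hker := QuotientAddGroup.ker_mk' (AddSubgroup.zmultiples g)
    have hmem : g ∈ (QuotientAddGroup.mk' (AddSubgroup.zmultiples g)).ker := by
      rw [hker]; exact AddSubgroup.mem_zmultiples g
    refine IsSplittable.of_cyclic_odd_ker (QuotientAddGroup.mk' (AddSubgroup.zmultiples g))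
      (QuotientAddGroup.mk'_surjective _) (by rw [hker]; exact hcardN) ⟨g, hmem⟩ ?_
      (ih' _ ?_ (h.quotient hcardN hx))
    · rintro ⟨y, hy⟩
      rw [hker] at hy
      obtain ⟨k, hk⟩ := AddSubgroup.mem_zmultiples_iff.1 hy
      exact AddSubgroup.mem_zmultiples_iff.2 ⟨k, Subtype.ext hk⟩
    · have h1 := AddSubgroup.card_eq_card_quotient_mul_card_addSubgroup (AddSubgroup.zmultiples g)
      have h2 : 1 < Nat.card (AddSubgroup.zmultiples g) := by
        have := AddSubgroup.nontrivial_iff_ne_bot _ |>.2 (mt AddSubgroup.zmultiples_eq_bot.1 hg0)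
        exact Finite.one_lt_card
      have h3 : 0 < Nat.card ((∀ l, ZMod (n l)) ⧸ AddSubgroup.zmultiples g) := Nat.card_pos
      rw [h1]
      exact lt_mul_of_one_lt_right h3 h2
  -- All doubles lie in the multiples of `g`. Doubling the coordinate vectors forces every other
  -- modulus to divide 2, and `p i₀ ^ (e i₀ - 1)` to divide 2, so that `e i₀ = 1`.
  · push Not at hx
    have hone : ∀ i, ∃ k : ℤ, k • g = coord n i (2 * 1) := fun i => by
      rw [← coord_add_self]
      exact AddSubgroup.mem_zmultiples_iff.1 (hx _)
    have hother : ∀ i, i ≠ i₀ → n i = 2 := by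
      intro i hi
      obtain ⟨k, hk⟩ := hone i
      have h1 := congrFun hk i
      have h0 : g i = 0 := coord_of_ne hi _
      rw [coord_same, Pi.smul_apply, h0, smul_zero] at h1
      have h2 : n i ∣ 2 := (ZMod.natCast_eq_zero_iff _ _).1 h1.symm
      exact ((Nat.dvd_prime Nat.prime_two).1 h2).resolve_left
        (Nat.one_lt_pow (he i) (hp i).one_lt).ne'
    have he1 : e i₀ = 1 := by
      obtain ⟨k, hk⟩ := hone i₀
      have h1 : p i₀ • coord n i₀ (2 * 1) = 0 := by
        rw [← hk, smul_comm, hpg, smul_zero]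
      have h2 := congrFun h1 i₀
      rw [Pi.smul_apply, coord_same, nsmul_eq_mul, ← Nat.cast_mul, Pi.zero_apply,
        ZMod.natCast_eq_zero_iff] at h2
      have h3 : p i₀ * p i₀ ^ (e i₀ - 1) ∣ p i₀ * 2 := by rw [hpe]; exact h2
      have h4 := Nat.dvd_of_mul_dvd_mul_left hp₀.pos h3
      by_contra hne1
      have h5 : p i₀ ∣ 2 := (dvd_pow_self _ (by have := he i₀; omega)).trans h4
      exact hi₀ ((Nat.prime_dvd_prime_iff_eq hp₀ Nat.prime_two).1 h5)
    have hn₀ : n i₀ = p i₀ := by rw [hn]; simp [he1]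
    have : Fact (n i₀).Prime := ⟨hn₀ ▸ hp₀⟩
    exact isSplittable_elementary_prod_prime (i₀ := i₀) (by rw [he1, pow_one]; exact hi₀) hother h ih'

/-- The group condition for even cycles yields an ample group. -/
theorem isAmple_of_cycleCondition {n : ℕ} {K : Type*} [AddCommGroup K] (hn : Even n)
    (h : CycleCondition n K) : IsAmple K := by
  obtain ⟨-, hodd | ⟨-, s, hs, S, ⟨e⟩⟩⟩ := h
  · exact absurd hodd (Nat.not_odd_iff_even.2 hn)
  have hs0 : ((s : ℕ) : ZMod (2 * s)) ≠ 0 := by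
    rw [Ne, ZMod.natCast_eq_zero_iff]
    intro h
    have := Nat.le_of_dvd (by omega) h
    omega
  have h2 : ((2 : ℕ) : ZMod (2 * s)) ≠ 0 := by
    rw [Ne, ZMod.natCast_eq_zero_iff]
    intro h
    have := Nat.le_of_dvd (by omega) h
    omega
  have hss : (s : ZMod (2 * s)) + s = 0 := by
    have : ((2 * s : ℕ) : ZMod (2 * s)) = 0 := ZMod.natCast_self _
    rw [← two_mul]; exact_mod_cast this
  have h11 : (1 : ZMod 2) + 1 = 0 := by decide
  have h10 : (1 : ZMod 2) ≠ 0 := by decide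
  have base : IsAmple (ZMod 2 × ZMod (2 * s)) := by
    refine ⟨⟨(1, 0), (0, s), ?_, ?_, ?_, ?_, ?_⟩, (0, 1), ?_⟩
    · exact fun h => h10 (congrArg Prod.fst h)
    · exact fun h => hs0 (congrArg Prod.snd h)
    · exact fun h => h10 (congrArg Prod.fst h)
    · exact Prod.ext h11 (add_zero 0)
    · exact Prod.ext (add_zero 0) hss
    · intro h
      have : (1 : ZMod (2 * s)) + 1 = 0 := congrArg Prod.snd h
      rw [one_add_one_eq_two] at this
      exact h2 (by exact_mod_cast this)
  exact base.of_injective (S.subtype.comp e.symm.toAddMonoidHom)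
    (S.subtype_injective.comp e.symm.injective)

theorem mainTheorem6 {Γ : Type*} [AddCommGroup Γ] [Finite Γ] (n m : ℕ)
    (hn : Even n) (hm : Odd m) (hΓ : Nat.card Γ = m * n)
    (hH : ∃ H : AddSubgroup Γ, Nat.card H = m ∧ CycleCondition n (Γ ⧸ H)) :
    IsHarmonious (dutchWindmill n m) Γ := by
  obtain ⟨H, hHm, hK⟩ := hH
  have hA := isAmple_of_cycleCondition hn hK
  have h2n : 2 < n := by
    obtain ⟨⟨a, b, ha, hb, hab, -⟩, -⟩ := hA
    rw [← hK.1]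
    have hinj : Function.Injective (![0, a, b] : Fin 3 → Γ ⧸ H) := by
      intro i j hij
      fin_cases i <;> fin_cases j <;> simp_all [eq_comm]
    have := Nat.card_le_card_of_injective _ hinj
    rw [Nat.card_fin] at this
    omega
  -- The induction is stated for groups in `Type`; the product of cyclic groups is a model of the
  -- quotient there. From splittability only the single cycle is kept, the second mapping having
  -- served the induction.
  obtain ⟨ι, _, p, e, hp, -, ⟨f⟩⟩ := exists_addEquiv_pi_zmod (Γ ⧸ H)
  have : Finite (∀ i, ZMod (p i ^ e i)) := Finite.of_equiv _ f.toEquiv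
  have hS := (hA.of_injective f.toAddMonoidHom f.injective).isSplittable.of_addEquiv f.symm
  obtain ⟨θ, -, hθ, -, hc, -⟩ := hS
  exact isHarmonious_dutchWindmill h2n hm hΓ H hHm hK.1 θ hθ hc
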